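/- **Theorem 2.1.** Let $p$ be a prime, let $F$ be a field of characteristic $p$, and let $\mathbb{Z}/p$ be the cyclic group of order $p$ with generator $\sigma$. For $1\le n\le p$ let $V_n$ be the indecomposable $F\mathbb{Z}/p$-module of dimension $n$ on which $\sigma$ acts by a single $n\times n$ Jordan block with eigenvalue $1$, and write $mV_n$ for the direct sum of $m$ copies of $V_n$. For a finite-dimensional $F\mathbb{Z}/p$-module $W$ put $F[W]=S(W^*)$, with $\mathbb{Z}/p$ acting by the algebra automorphisms extending its action on $W^*$, and let the Noether number $\beta(W)$ be the least integer $d$ such that the ring of invariants $F[W]^{\mathbb{Z}/p}$ is generated as an $F$-algebra by homogeneous elements of degree at most $d$. Call $W$ reduced if it has no non-zero direct summand on which $\mathbb{Z}/p$ acts trivially. An invariant is called indecomposable if it lies in the ideal $F[W]^{\mathbb{Z}/p}_+$ of invariants with zero constant term but is not a finite sum of products $fh$ with $f,h\in F[W]^{\mathbb{Z}/p}_+$. Put $\Delta=\sigma-1$ and $\mathrm{Tr}=\sum_{i=1}^{p}\sigma^i$. Let $W$ be a non-zero reduced finite-dimensional $F\mathbb{Z}/p$-module and $k=\dim_F W^{\mathbb{Z}/p}$.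 1. If $W$ has a direct summand isomorphic to $V_n$ for some $n$ with $3<n\le p$, then $\beta(W)\ge k(p-1)+p-2$. 2. If $W$ has a direct summand isomorphic to $V_n$ for some $n$ with $2<n\le p$, then $\beta(W)\ge k(p-1)+1$. Moreover, for every integer $k\ge 1$: 3. If $p\ge 4$ and $x_1,y_1,\dots,x_{k-1},y_{k-1},w,x,y,z$ is a basis of $((k-1)V_2+V_4)^*$ with $\Delta y_i=x_i$, $\Delta x_i=0$, $\Delta z=y$, $\Delta y=x$, $\Delta x=w$, $\Delta w=0$, then $\mathrm{Tr}\big((y_1\cdots y_{k-1}z)^{p-1}y^{p-2}\big)$ is indecomposable in $F[(k-1)V_2+V_4]^{\mathbb{Z}/p}$. 4. If $p\ge 3$ and $x_1,y_1,\dots,x_{k-1},y_{k-1},x,y,z$ is a basis of $((k-1)V_2+V_3)^*$ with $\Delta y_i=x_i$, $\Delta x_i=0$, $\Delta z=y$, $\Delta y=x$, $\Delta x=0$, then $\mathrm{Tr}\big((y_1\cdots y_{k-1}z)^{p-1}y\big)$ is indecomposable in $F[(k-1)V_2+V_3]^{\mathbb{Z}/p}$. -/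

import Mathlib

open scoped DirectSum

noncomputable section

namespace NoetherNumber

/-! ### Rings of invariants and Noether numbers -/

section Invariants

variable {F G V : Type*} [Field F] [Group G] [AddCommGroup V] [Module F V]

/-- The coordinate ring `F[V] = S(V*)` of a representation. -/
abbrev CoordRing (F V : Type*) [Field F] [AddCommGroup V] [Module F V] : Type _ :=
  SymmetricAlgebra F (Module.Dual F V)

/-- A linear functional on `V`, viewed as an element of degree one of `F[V]`. -/
abbrev coord (φ : Module.Dual F V) : CoordRing F V := SymmetricAlgebra.ι F (Module.Dual F V) φ

/-- The action of `G` on `F[V]` by algebra homomorphisms extending the (contragredient) action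
on `V*`. -/
def action (ρ : Representation F G V) : G →* (CoordRing F V →ₐ[F] CoordRing F V) where
  toFun g := SymmetricAlgebra.lift (SymmetricAlgebra.ι F (Module.Dual F V) ∘ₗ ρ.dual g)
  map_one' := by
    apply SymmetricAlgebra.algHom_ext
    ext φ
    simp only [map_one]
    simp
  map_mul' g h := by
    apply SymmetricAlgebra.algHom_ext
    ext φ
    simp only [map_mul]
    simp

/-- The ring of invariants `F[V]^G`. -/
def invariantRing (ρ : Representation F G V) : Subalgebra F (CoordRing F V) where
  carrier := {f | ∀ g, action ρ g f = f}
  mul_mem' ha hb g := by rw [map_mul, ha g, hb g]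
  add_mem' ha hb g := by rw [map_add, ha g, hb g]
  algebraMap_mem' r g := AlgHom.commutes _ r

/-- The homogeneous component of degree `d` of `F[V]`: the span of the products of `d` linear
functionals. -/
def homogeneousPart (F V : Type*) [Field F] [AddCommGroup V] [Module F V] (d : ℕ) :
    Submodule F (CoordRing F V) :=
  LinearMap.range (SymmetricAlgebra.ι F (Module.Dual F V)) ^ d

/-- `F[V]^G` is generated, as an `F`-algebra, by homogeneous invariants of degree at most `d`. -/
def GeneratedInDegree (ρ : Representation F G V) (d : ℕ) : Prop :=
  Algebra.adjoin F {f | f ∈ invariantRing ρ ∧ ∃ m ≤ d, f ∈ homogeneousPart F V m} =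
    invariantRing ρ

/-- The Noether number `β(V)`: the least `d` such that `F[V]^G` is generated by homogeneous
elements of degree at most `d`. -/
def beta (ρ : Representation F G V) : ℕ := sInf {d | GeneratedInDegree ρ d}

/-- The transfer `Tr(f) = ∑ g • f`, as an invariant. -/
def transfer [Fintype G] (ρ : Representation F G V) (f : CoordRing F V) : invariantRing ρ :=
  ⟨∑ g, action ρ g f, fun h => by
    rw [map_sum]
    refine Fintype.sum_equiv (Equiv.mulLeft h) _ _ fun g => ?_
    simp⟩

/-- The ideal of the invariants with zero constant term. -/
def positiveIdeal (ρ : Representation F G V) : Ideal (invariantRing ρ) :=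
  RingHom.ker ((SymmetricAlgebra.algebraMapInv (R := F) (M := Module.Dual F V)).comp
    (invariantRing ρ).val)

/-- An invariant is indecomposable if it has zero constant term, but is not a sum of products of
two invariants with zero constant term. -/
def IsIndecomposable (ρ : Representation F G V) (f : invariantRing ρ) : Prop :=
  f ∈ positiveIdeal ρ ∧ f ∉ positiveIdeal ρ ^ 2

/-! ### Summands -/

/-- `ρ` contains a (direct) summand isomorphic to `τ`. -/
def HasSummand {U : Type*} [AddCommGroup U] [Module F U] (ρ : Representation F G V)
    (τ : Representation F G U) : Prop :=
  ∃ A B : Subrepresentation ρ, IsCompl A.toSubmodule B.toSubmodule ∧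
    Nonempty (A.toRepresentation.Equiv τ)

/-- `ρ` is reduced: it has no (nonzero) summand with trivial action. -/
def IsReducedRep (ρ : Representation F G V) : Prop :=
  ∀ A B : Subrepresentation ρ, IsCompl A.toSubmodule B.toSubmodule →
    (∀ g, ∀ v ∈ A.toSubmodule, ρ g v = v) → A.toSubmodule = ⊥

end Invariants

/-! ### Modules for the cyclic group of order `p` -/

/-- The cyclic group of order `p`, written multiplicatively. -/
abbrev Cyc (p : ℕ) : Type := Multiplicative (ZMod p)

/-- The chosen generator `σ`. -/
def sigma (p : ℕ) : Cyc p := Multiplicative.ofAdd 1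

section Cyclic

variable (F : Type*) [Field F] (p n : ℕ)

/-- The `n × n` matrix with ones on the superdiagonal and zeros elsewhere. -/
def shiftMatrix : Matrix (Fin n) (Fin n) F := .of fun i j => if (i : ℕ) + 1 = j then 1 else 0

/-- The `n × n` Jordan block with eigenvalue `1`. -/
def jordanBlock : Matrix (Fin n) (Fin n) F := 1 + shiftMatrix F n

lemma shiftMatrix_pow (m : ℕ) (i j : Fin n) :
    (shiftMatrix F n ^ m) i j = if (i : ℕ) + m = j then 1 else 0 := by
  induction m generalizing i j with
  | zero => simp [Matrix.one_apply, Fin.ext_iff]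
  | succ m ih =>
    have hs (k : Fin n) :
        shiftMatrix F n k j = if (k : ℕ) + 1 = j then 1 else 0 := rfl
    rw [pow_succ, Matrix.mul_apply]
    simp only [ih, hs]
    by_cases h : (i : ℕ) + m < n
    · rw [Finset.sum_eq_single (⟨i + m, h⟩ : Fin n)]
      · simp [add_assoc]
      · intro b _ hb
        rw [if_neg, zero_mul]
        intro h'
        exact hb (Fin.ext h'.symm)
      · simp
    · rw [Finset.sum_eq_zero, if_neg]
      · have := j.2
        omega
      · intro x _
        have := x.2
        rw [if_neg (by omega), zero_mul]

variable [Fact p.Prime] [CharP F p]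

variable {n} in
lemma jordanBlock_pow (h : n ≤ p) : jordanBlock F n ^ p = 1 := by
  rcases Nat.eq_zero_or_pos n with rfl | hn
  · exact Subsingleton.elim _ _
  · have : Nonempty (Fin n) := ⟨⟨0, hn⟩⟩
    rw [jordanBlock, add_pow_char_of_commute _ (Commute.one_left _), one_pow]
    ext i j
    have := j.2
    rw [Matrix.add_apply, shiftMatrix_pow, if_neg (by omega), add_zero]

/-- The indecomposable module `V_n`, for `n ≤ p`: the space `F ^ n`, with `σ` acting by the
`n × n` Jordan block with eigenvalue `1`. -/
def jordanRep (h : n ≤ p) : Representation F (Cyc p) (Fin n → F) where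
  toFun g := Matrix.toLin' (jordanBlock F n ^ (Multiplicative.toAdd g).val)
  map_one' := by
    simp only [toAdd_one, ZMod.val_zero, pow_zero, Matrix.toLin'_one]
    rfl
  map_mul' a b := by
    rw [toAdd_mul, ZMod.val_add, ← pow_eq_pow_mod _ (jordanBlock_pow F p h), pow_add,
      Matrix.toLin'_mul]
    rfl

lemma jordanRep_sigma (h : n ≤ p) :
    jordanRep F p n h (sigma p) = Matrix.toLin' (jordanBlock F n) := by
  have : Fact (1 < p) := ⟨(Fact.out : p.Prime).one_lt⟩
  simp [jordanRep, sigma, ZMod.val_one]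

/-- The module `m V_2 + V_n`. -/
def twosPlus (m n : ℕ) (h2 : 2 ≤ p) (h : n ≤ p) :
    Representation F (Cyc p) ((⨁ _ : Fin m, (Fin 2 → F)) × (Fin n → F)) :=
  (Representation.directSum fun _ : Fin m => jordanRep F p 2 h2).prod (jordanRep F p n h)

end Cyclic

/-- The operator `Δ = σ - 1` on a `Z/p`-module. -/
def Delta {F V : Type*} [Field F] [AddCommGroup V] [Module F V] {p : ℕ}
    (ρ : Representation F (Cyc p) V) : V →ₗ[F] V :=
  ρ (sigma p) - 1

/-- `b` is a Jordan basis of a `Z/p`-module of type `m V_2 + V_n`. Writing `x_i = b (inl (i, 0))`,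
`y_i = b (inl (i, 1))` and `u_j = b (inr j)`, this says `Δ y_i = x_i`, `Δ x_i = 0`,
`Δ u_{j+1} = u_j` and `Δ u_0 = 0`. -/
def IsJordanBasis {F V : Type*} [Field F] [AddCommGroup V] [Module F V] {p m n : ℕ}
    (ρ : Representation F (Cyc p) V) (b : Module.Basis ((Fin m × Fin 2) ⊕ Fin n) F V) : Prop :=
  (∀ i : Fin m, Delta ρ (b (.inl (i, 1))) = b (.inl (i, 0))) ∧
  (∀ i : Fin m, Delta ρ (b (.inl (i, 0))) = 0) ∧
  (∀ j j' : Fin n, (j' : ℕ) = j + 1 → Delta ρ (b (.inr j')) = b (.inr j)) ∧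
  (∀ j : Fin n, (j : ℕ) = 0 → Delta ρ (b (.inr j)) = 0)

end NoetherNumber

end

open NoetherNumber

/-!
The lower bounds for the Noether number come from transfers that cannot be decomposed. If
`F[W]^G` is generated in degree at most `d`, then every homogeneous invariant of degree greater than
`d` is a sum of products of invariants without constant term; so an indecomposable transfer of
degree `D` forces `D ≤ d`. All four assertions are proved with one linear functional
(`JordanFrame.topCoeff`): restrict `f` to the points `∑ s_i Y_i + u Y`, where `Y_i` and `Y` are the
vectors dual to the coordinates `y_i` and `y`, and take the coefficient of
`(s_1 ⋯ s_m) ^ (p - 1) u ^ N`.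

* On `Tr((y_1 ⋯ y_m z) ^ (p - 1) y ^ e)` with `N = p - 1 + e` the functional has the value
  `∑ c ^ (p - 1) = -1`, the sum being over `c ∈ 𝔽_p` (`JordanFrame.topCoeff_transfer`).
* It vanishes on products of two invariants without constant term. A product contributes only
  through pairs of monomials `s ^ A u ^ a` and `s ^ B u ^ b` with `a + b = N` and all exponents in
  `A` and `B` at most `p - 1`. If `a = 0`, the first monomial does not occur in an invariant,
  since the partial derivatives in the `s_i` vanish (`JordanFrame.coeff_coeff_zero_linePoint`). If
  `a` and `b` are positive, one of the two powers of `u` does not occur. For the block of size four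
  this is because no invariant of `V_4` contains `y ^ a` with `1 ≤ a ≤ p - 2`, and for the block of
  size three because no invariant of `V_3` contains `y ^ a` with `a` odd and less than `p`
  (`coeff_eq_zero_of_unipotentShift_three`, `coeff_eq_zero_of_unipotentShift_two`).

The last two facts are obtained by comparing the values of an invariant at two points of one orbit,
both with `z = 0`, as polynomials in the number `c` of steps between them: these polynomials agree
on `𝔽_p` and have degree less than `p`, hence coincide, but their top coefficients differ unless the
coefficient of `y ^ a` vanishes.

The functional only needs some vectors and coordinates, collected in `JordanFrame`, rather than a
decomposition of the whole module. In a reduced module `W` such a frame exists with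
`m = dim W^G - 1`, because every fixed vector is in the image of `σ⁻¹ - 1`
(`IsReducedRep.nonempty_jordanFrame`). Finally, as `beta` is an infimum of natural numbers, the
bounds also require that the invariants be generated in some bounded degree at all, which is
Noether's finiteness theorem (`exists_generatedInDegree`).
-/

namespace NoetherNumber

/-! ### Polynomials fixed by a unipotent substitution -/

section UnipotentShift

open Polynomial

variable {S : Type*} [CommRing S]

/-- The substitution by which a single Jordan block acts on its coordinates: it fixes the first
variable and adds to every other variable its predecessor. -/
noncomputable def unipotentShift (S : Type*) [CommRing S] (n : ℕ) :
    MvPolynomial (Fin (n + 1)) S →ₐ[S] MvPolynomial (Fin (n + 1)) S :=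
  MvPolynomial.aeval
    (Fin.cons (MvPolynomial.X 0) fun i => MvPolynomial.X i.succ + MvPolynomial.X i.castSucc)

lemma homogeneousComponent_aeval {σ τ : Type*} (g : σ → MvPolynomial τ S)
    (hg : ∀ i, (g i).IsHomogeneous 1) (d : ℕ) (f : MvPolynomial σ S) :
    MvPolynomial.homogeneousComponent d (MvPolynomial.aeval g f) =
      MvPolynomial.aeval g (MvPolynomial.homogeneousComponent d f) := by
  have hom (i : ℕ) : (MvPolynomial.aeval g (MvPolynomial.homogeneousComponent i f)).IsHomogeneous i
      := by
    simpa using (MvPolynomial.homogeneousComponent_isHomogeneous i f).aeval g hg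
  conv_lhs => rw [← MvPolynomial.sum_homogeneousComponent f]
  rw [map_sum, map_sum]
  simp_rw [fun i => MvPolynomial.homogeneousComponent_of_mem (m := d)
    ((MvPolynomial.mem_homogeneousSubmodule _ _).2 (hom i))]
  rw [Finset.sum_ite_eq]
  split_ifs with h
  · rfl
  · rw [MvPolynomial.homogeneousComponent_eq_zero _ _ (by simpa using h), map_zero]

lemma unipotentShift_homogeneousComponent {n : ℕ} {f : MvPolynomial (Fin (n + 1)) S}
    (hf : unipotentShift S n f = f) (d : ℕ) :
    unipotentShift S n (MvPolynomial.homogeneousComponent d f) =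
      MvPolynomial.homogeneousComponent d f := by
  conv_rhs => rw [← hf]
  refine (homogeneousComponent_aeval _ (fun i => ?_) d f).symm
  refine Fin.cases ?_ (fun j => ?_) i
  · exact MvPolynomial.isHomogeneous_X _ _
  · exact (MvPolynomial.isHomogeneous_X _ _).add (MvPolynomial.isHomogeneous_X _ _)

/-- A polynomial fixed by the shift is constant along every orbit of the corresponding map on
points. -/
lemma aeval_orbit_eq {n : ℕ} {f : MvPolynomial (Fin (n + 1)) S} (hf : unipotentShift S n f = f)
    {B : Type*} [CommRing B] [Algebra S B] (z : ℕ → Fin (n + 1) → B)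
    (h0 : ∀ t, z (t + 1) 0 = z t 0)
    (hs : ∀ t (i : Fin n), z (t + 1) i.succ = z t i.succ + z t i.castSucc) (t : ℕ) :
    MvPolynomial.aeval (z t) f = MvPolynomial.aeval (z 0) f := by
  induction t with
  | zero => rfl
  | succ t ih =>
    rw [← ih]
    conv_rhs => rw [← hf]
    rw [← AlgHom.comp_apply]
    congr 1
    refine MvPolynomial.algHom_ext fun i => ?_
    refine Fin.cases ?_ (fun j => ?_) i <;> simp [unipotentShift, h0, hs]

/-- For polynomials in two variables `ε` (outer) and `c` (inner): the coefficient of `ε ^ i` has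
degree at most `n + κ * i` in `c`. -/
def DegreeBound (κ n : ℕ) (b : S[X][X]) : Prop :=
  ∀ i, (b.coeff i).natDegree ≤ n + κ * i

namespace DegreeBound

variable {κ m n : ℕ} {a b : S[X][X]}

lemma mono (hmn : m ≤ n) (h : DegreeBound κ m a) : DegreeBound κ n a :=
  fun i => (h i).trans (by omega)

lemma mul (ha : DegreeBound κ m a) (hb : DegreeBound κ n b) : DegreeBound κ (m + n) (a * b) := by
  intro i
  rw [coeff_mul]
  refine natDegree_sum_le_of_forall_le _ _ fun x hx => natDegree_mul_le.trans ?_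
  rw [← Finset.HasAntidiagonal.mem_antidiagonal.1 hx]
  have h1 := ha x.1
  have h2 := hb x.2
  rw [mul_add]
  omega

lemma one : DegreeBound κ 0 (1 : S[X][X]) := by
  intro i
  rw [coeff_one]
  split_ifs <;> simp

lemma pow (ha : DegreeBound κ m a) (e : ℕ) : DegreeBound κ (e * m) (a ^ e) := by
  induction e with
  | zero => simpa using one
  | succ e ih =>
    rw [pow_succ, add_mul, one_mul]
    exact ih.mul ha

lemma prod {ι : Type*} (s : Finset ι) {g : ι → S[X][X]} {d : ι → ℕ}
    (h : ∀ i ∈ s, DegreeBound κ (d i) (g i)) : DegreeBound κ (∑ i ∈ s, d i) (∏ i ∈ s, g i) := by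
  induction s using Finset.cons_induction with
  | empty => simpa using one
  | cons i s hi ih =>
    rw [Finset.prod_cons, Finset.sum_cons]
    exact (h i (Finset.mem_cons_self i s)).mul
      (ih fun j hj => h j (Finset.mem_cons_of_mem hj))

lemma smul (s : S) (ha : DegreeBound κ m a) : DegreeBound κ m (algebraMap S S[X][X] s * a) := by
  have : DegreeBound κ 0 (algebraMap S S[X][X] s) := by
    intro i
    rw [Polynomial.algebraMap_apply, Polynomial.algebraMap_apply, coeff_C]
    split_ifs <;> simp
  simpa using this.mul ha

lemma sum {ι : Type*} (s : Finset ι) {g : ι → S[X][X]}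
    (h : ∀ i ∈ s, DegreeBound κ m (g i)) : DegreeBound κ m (∑ i ∈ s, g i) := by
  intro i
  rw [finsetSum_coeff]
  exact natDegree_sum_le_of_forall_le _ _ fun x hx => h x hx i

end DegreeBound

lemma aeval_eq_sum_algebraMap {σ B : Type*} [Fintype σ] [CommRing B] [Algebra S B] (P : σ → B)
    (f : MvPolynomial σ S) :
    MvPolynomial.aeval P f =
      ∑ d ∈ f.support, algebraMap S B (f.coeff d) * ∏ i, P i ^ d i := by
  rw [MvPolynomial.aeval_def, MvPolynomial.eval₂_eq']

lemma apply_le_of_isHomogeneous {σ : Type*} {f : MvPolynomial σ S} {a : ℕ} {j : σ}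
    (hf : f.IsHomogeneous a) {d : σ →₀ ℕ} (hd : d ∈ f.support) :
    d j ≤ a := by
  have : Finsupp.degree d = a := by
    by_contra h
    exact (MvPolynomial.mem_support_iff.1 hd) (hf.coeff_eq_zero h)
  exact this ▸ Finsupp.le_degree j d

lemma degreeBound_aeval {σ : Type*} [Fintype σ] {f : MvPolynomial σ S} {a κ : ℕ}
    {P : σ → S[X][X]} (hf : f.IsHomogeneous a) (h : ∀ i, DegreeBound κ 1 (P i)) :
    DegreeBound κ a (MvPolynomial.aeval P f) := by
  rw [aeval_eq_sum_algebraMap]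
  refine DegreeBound.sum _ fun d hd => DegreeBound.smul _ ?_
  have hdeg : Finsupp.degree d = a := by
    by_contra h
    exact (MvPolynomial.mem_support_iff.1 hd) (hf.coeff_eq_zero h)
  have := DegreeBound.prod (κ := κ) Finset.univ (g := fun i => P i ^ d i)
    (d := fun i => d i * 1) fun i _ => (h i).pow _
  simpa [← Finsupp.degree_eq_sum, hdeg] using this

section Homogeneous

variable {σ : Type*} [Fintype σ] [DecidableEq σ] {f : MvPolynomial σ S} {a κ : ℕ}
  {P : σ → S[X][X]} {j : σ}

lemma degreeBound_monomial (h1 : DegreeBound κ 1 (P j))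
    (h0 : ∀ i ≠ j, DegreeBound κ 0 (P i)) (d : σ →₀ ℕ) :
    DegreeBound κ (d j) (∏ i, P i ^ d i) := by
  have := DegreeBound.prod (κ := κ) Finset.univ (g := fun i => P i ^ d i)
    (d := fun i => d i * if i = j then 1 else 0) fun i _ => by
      refine DegreeBound.pow ?_ _
      split_ifs with h
      · exact h ▸ h1
      · exact h0 i h
  simpa using this

/-- If only the `j`-th coordinate of `P` may involve `c` in degree one, then the top coefficient of
`f(P)` depends only on the pure power of the `j`-th variable in `f`. -/
lemma coeff_coeff_aeval (hf : f.IsHomogeneous a) (h1 : DegreeBound κ 1 (P j))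
    (h0 : ∀ i ≠ j, DegreeBound κ 0 (P i)) (i : ℕ) :
    ((MvPolynomial.aeval P f).coeff i).coeff (a + κ * i) =
      f.coeff (Finsupp.single j a) * ((P j ^ a).coeff i).coeff (a + κ * i) := by
  have key (d : σ →₀ ℕ) : ((algebraMap S S[X][X] (f.coeff d) * ∏ i, P i ^ d i).coeff i).coeff
      (a + κ * i) = f.coeff d * ((∏ i, P i ^ d i).coeff i).coeff (a + κ * i) := by
    rw [Polynomial.algebraMap_apply, Polynomial.algebraMap_apply, coeff_C_mul]
    exact coeff_C_mul _
  rw [aeval_eq_sum_algebraMap, finsetSum_coeff, finsetSum_coeff]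
  simp_rw [key]
  rw [Finset.sum_eq_single (Finsupp.single j a)]
  · congr 3
    rw [Finset.prod_eq_single j]
    · simp
    · intro k _ hk
      simp [Finsupp.single_eq_of_ne hk]
    · simp
  · intro d hd hne
    have hlt : d j < a := by
      refine lt_of_le_of_ne (apply_le_of_isHomogeneous hf hd) fun h => hne ?_
      have hdeg : Finsupp.degree d = a := by
        by_contra h
        exact (MvPolynomial.mem_support_iff.1 hd) (hf.coeff_eq_zero h)
      have hle : Finsupp.single j a ≤ d := by
        rw [Finsupp.single_le_iff, h]
      have := Finsupp.degree_eq_zero_iff (d - Finsupp.single j a) |>.1 (by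
        have h3 := congrArg Finsupp.degree (tsub_add_cancel_of_le hle)
        rw [map_add, hdeg, Finsupp.degree_single] at h3
        omega)
      rw [← tsub_add_cancel_of_le hle, this, zero_add]
    rw [coeff_eq_zero_of_natDegree_lt, mul_zero]
    exact (degreeBound_monomial h1 h0 d i).trans_lt (by omega)
  · intro h
    rw [MvPolynomial.notMem_support_iff.1 h, zero_mul]

end Homogeneous

lemma eq_of_eval_natCast_eq [IsDomain S] (p : ℕ) [CharP S p] {r l : S[X]} (hr : r.natDegree < p) (hl : l.natDegree < p)
    (h : ∀ c : ℕ, r.eval (c : S) = l.eval (c : S)) : r = l := by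
  refine eq_of_natDegree_lt_card_of_eval_eq r l (f := fun i : Fin p => ((i : ℕ) : S)) ?_
    (fun i => h i) (by simp [hr, hl])
  intro i j hij
  exact Fin.ext (CharP.natCast_injOn_Iio S p i.2 j.2 hij)

/-- Evaluation of the inner variable `c` at a natural number. -/
noncomputable def evalInner (S : Type*) [CommRing S] (c : ℕ) : S[X][X] →ₐ[S] S[X] :=
  Polynomial.mapAlgHom (Polynomial.aeval (c : S))

@[simp]
lemma evalInner_X (c : ℕ) : evalInner S c X = X := by simp [evalInner]

@[simp]
lemma evalInner_C_X (c : ℕ) : evalInner S c (C X) = (c : S[X]) := by simp [evalInner]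

lemma coeff_eq_of_evalInner_eq [IsDomain S] (p : ℕ) [CharP S p] {r l : S[X][X]} {i : ℕ}
    (hr : (r.coeff i).natDegree < p) (hl : (l.coeff i).natDegree < p)
    (h : ∀ c : ℕ, evalInner S c r = evalInner S c l) : r.coeff i = l.coeff i := by
  refine eq_of_eval_natCast_eq p hr hl fun c => ?_
  simpa [evalInner, Polynomial.coe_aeval_eq_eval] using congrArg (fun q => q.coeff i) (h c)

lemma coeff_single_eq_coeff_homogeneousComponent {σ : Type*} (f : MvPolynomial σ S) (j : σ) (a : ℕ) :
    f.coeff (Finsupp.single j a) =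
      (MvPolynomial.homogeneousComponent a f).coeff (Finsupp.single j a) := by
  rw [MvPolynomial.coeff_homogeneousComponent, if_pos (Finsupp.degree_single j a)]

lemma degreeBound_linear {κ n : ℕ} {u v : S[X]} (hu : u.natDegree ≤ n)
    (hv : v.natDegree ≤ n + κ) : DegreeBound κ n (C u + X * C v) := by
  intro i
  rcases i with _ | _ | i
  · simpa using hu
  · simpa [coeff_C] using hv
  · simp

lemma coeff_linear_pow (u : S[X]) (a : ℕ) :
    (((C u + X * C (u ^ 2)) ^ a).coeff 0 = u ^ a) ∧
      (((C u + X * C (u ^ 2)) ^ a).coeff 1 = a * u ^ (a + 1)) := by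
  induction a with
  | zero => simp [coeff_one]
  | succ a ih =>
    have h0 : (C u + X * C (u ^ 2)).coeff 0 = u := by simp
    have h1 : (C u + X * C (u ^ 2)).coeff 1 = u ^ 2 := by
      rw [coeff_add, coeff_X_mul, coeff_C_zero, coeff_C_of_ne_zero one_ne_zero, zero_add]
    rw [pow_succ, mul_coeff_zero, mul_coeff_one, ih.1, ih.2, h0, h1]
    refine ⟨(pow_succ u a).symm, ?_⟩
    push_cast
    ring

/-- A polynomial fixed by the four-dimensional shift contains no pure power of the third variable of
positive degree less than `p - 1`. The points `(Δ³z, Δ²z, Δz, z)(t)` for the cubic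
`z(t) = t (c - t) (1 + ε (c - t))` form an orbit, and `z` vanishes at both `t = 0` and `t = c`. The
value at `t = 0` has the coefficient of the pure power as its coefficient of `ε c ^ (a + 1)`, up to
the factor `a`; the value at `t = c` has degree at most `a` in `c`. -/
theorem coeff_eq_zero_of_unipotentShift_three [IsDomain S] (p : ℕ) [CharP S p]
    {f : MvPolynomial (Fin 4) S} (hf : unipotentShift S 3 f = f) {a : ℕ} (ha : 0 < a)
    (hap : a + 1 < p) : f.coeff (Finsupp.single 2 a) = 0 := by
  rw [coeff_single_eq_coeff_homogeneousComponent]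
  have hg := unipotentShift_homogeneousComponent hf a
  have hom := MvPolynomial.homogeneousComponent_isHomogeneous a f
  set g := MvPolynomial.homogeneousComponent a f
  -- the orbit points at `t = 0` and at `t = c`
  let R : Fin 4 → S[X][X] := ![C 0 + X * C 6, C (-2) + X * C (6 - 4 * X),
    C (X - 1) + X * C ((X - 1) ^ 2), C 0 + X * C 0]
  let T : Fin 4 → S[X][X] := ![C 0 + X * C 6, C (-2) + X * C (6 + 2 * X),
    C (-(X + 1)) + X * C (X + 1), C 0 + X * C 0]
  have hRT (c : ℕ) : evalInner S c (MvPolynomial.aeval R g) =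
      evalInner S c (MvPolynomial.aeval T g) := by
    let z : ℕ → S[X] := fun t =>
      (t : S[X]) * (c - t) * (1 + (X : S[X]) * (c - t))
    let w : ℕ → Fin 4 → S[X] := fun t =>
      ![z (t + 3) - 3 * z (t + 2) + 3 * z (t + 1) - z t, z (t + 2) - 2 * z (t + 1) + z t,
        z (t + 1) - z t, z t]
    have hw := aeval_orbit_eq hg w
      (fun t => by simp only [w, z, Matrix.cons_val_zero]; push_cast; ring)
      (fun t i => by fin_cases i <;> simp [w, add_assoc] <;> ring) c
    have h0 : MvPolynomial.aeval (w 0) g = evalInner S c (MvPolynomial.aeval R g) := by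
      rw [← AlgHom.comp_apply]
      congr 1
      refine MvPolynomial.algHom_ext fun i => ?_
      fin_cases i <;> simp [w, z, R, map_ofNat] <;> ring
    have h1 : MvPolynomial.aeval (w c) g = evalInner S c (MvPolynomial.aeval T g) := by
      rw [← AlgHom.comp_apply]
      congr 1
      refine MvPolynomial.algHom_ext fun i => ?_
      fin_cases i <;> simp [w, z, T, map_ofNat] <;> ring
    rw [← h0, ← h1, hw]
  have hR1 (i : Fin 4) : DegreeBound 1 (if i = 2 then 1 else 0) (R i) := by
    fin_cases i <;> refine degreeBound_linear ?_ ?_ <;> simp <;> compute_degree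
  have hRb : DegreeBound 1 a (MvPolynomial.aeval R g) :=
    degreeBound_aeval hom fun i => (hR1 i).mono (by split_ifs <;> simp)
  have hTb : DegreeBound 0 a (MvPolynomial.aeval T g) := degreeBound_aeval hom fun i => by
    fin_cases i <;> refine degreeBound_linear ?_ ?_ <;> compute_degree <;> norm_num
  have heq := coeff_eq_of_evalInner_eq p (i := 1) ((hRb 1).trans_lt (by omega))
    ((hTb 1).trans_lt (by omega)) hRT
  have htop := coeff_coeff_aeval (P := R) (j := 2) (κ := 1) hom (by simpa using hR1 2)
    (fun i hi => by simpa [hi] using hR1 i) 1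
  have hT0 : ((MvPolynomial.aeval T g).coeff 1).coeff (a + 1 * 1) = 0 :=
    coeff_eq_zero_of_natDegree_lt ((hTb 1).trans_lt (by omega))
  have hR2 : R 2 = C (X - 1) + X * C ((X - 1) ^ 2) := rfl
  have hmonic : ((X - 1 : S[X]) ^ (a + 1)).coeff (a + 1) = 1 := by
    have h : (X - 1 : S[X]) = X - C 1 := by simp
    have := ((monic_X_sub_C (1 : S)).pow (a + 1)).coeff_natDegree
    rwa [(monic_X_sub_C (1 : S)).natDegree_pow, natDegree_X_sub_C, mul_one, ← h] at this
  rw [heq, hT0, hR2, (coeff_linear_pow _ a).2, ← C_eq_natCast, coeff_C_mul, mul_one, hmonic,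
    mul_one] at htop
  have ha' : (a : S) ≠ 0 := fun h =>
    absurd (Nat.le_of_dvd ha ((CharP.cast_eq_zero_iff S p a).1 h)) (by omega)
  exact (mul_eq_zero.1 htop.symm).resolve_right ha'

/-- A polynomial fixed by the three-dimensional shift contains no pure power of the second variable
of odd degree less than `p`. The points `(Δ²z, Δz, z)(t)` for `z(t) = t (c - t)` form an orbit
from `(-2, c - 1, 0)` to `(-2, -c - 1, 0)`, and the top coefficients in `c` of the values at these
two points differ by the sign `(-1) ^ a`. -/
theorem coeff_eq_zero_of_unipotentShift_two [IsDomain S] (p : ℕ) [CharP S p] (hp : p ≠ 2)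
    {f : MvPolynomial (Fin 3) S} (hf : unipotentShift S 2 f = f) {a : ℕ} (ha : Odd a)
    (hap : a < p) : f.coeff (Finsupp.single 1 a) = 0 := by
  rw [coeff_single_eq_coeff_homogeneousComponent]
  have hg := unipotentShift_homogeneousComponent hf a
  have hom := MvPolynomial.homogeneousComponent_isHomogeneous a f
  set g := MvPolynomial.homogeneousComponent a f
  let R : Fin 3 → S[X][X] := ![C (-2) + X * C 0, C (X - 1) + X * C 0, C 0 + X * C 0]
  let T : Fin 3 → S[X][X] := ![C (-2) + X * C 0, C (-(X + 1)) + X * C 0, C 0 + X * C 0]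
  have hRT (c : ℕ) : evalInner S c (MvPolynomial.aeval R g) =
      evalInner S c (MvPolynomial.aeval T g) := by
    let z : ℕ → S[X] := fun t => (t : S[X]) * (c - t)
    let w : ℕ → Fin 3 → S[X] := fun t =>
      ![z (t + 2) - 2 * z (t + 1) + z t, z (t + 1) - z t, z t]
    have hw := aeval_orbit_eq hg w
      (fun t => by simp only [w, z, Matrix.cons_val_zero]; push_cast; ring)
      (fun t i => by fin_cases i <;> simp [w, add_assoc]; ring) c
    have h0 : MvPolynomial.aeval (w 0) g = evalInner S c (MvPolynomial.aeval R g) := by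
      rw [← AlgHom.comp_apply]
      congr 1
      refine MvPolynomial.algHom_ext fun i => ?_
      fin_cases i <;> simp [w, z, R, map_ofNat]; ring
    have h1 : MvPolynomial.aeval (w c) g = evalInner S c (MvPolynomial.aeval T g) := by
      rw [← AlgHom.comp_apply]
      congr 1
      refine MvPolynomial.algHom_ext fun i => ?_
      fin_cases i <;> simp [w, z, T, map_ofNat]; ring
    rw [← h0, ← h1, hw]
  have hR1 (i : Fin 3) : DegreeBound 0 (if i = 1 then 1 else 0) (R i) := by
    fin_cases i <;> refine degreeBound_linear ?_ ?_ <;> simp; compute_degree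
  have hT1 (i : Fin 3) : DegreeBound 0 (if i = 1 then 1 else 0) (T i) := by
    fin_cases i <;> refine degreeBound_linear ?_ ?_ <;> simp; compute_degree
  have hRb : DegreeBound 0 a (MvPolynomial.aeval R g) :=
    degreeBound_aeval hom fun i => (hR1 i).mono (by split_ifs <;> simp)
  have hTb : DegreeBound 0 a (MvPolynomial.aeval T g) :=
    degreeBound_aeval hom fun i => (hT1 i).mono (by split_ifs <;> simp)
  have heq := coeff_eq_of_evalInner_eq p (i := 0) ((hRb 0).trans_lt (by omega))
    ((hTb 0).trans_lt (by omega)) hRT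
  have hRtop := coeff_coeff_aeval (P := R) (j := 1) (κ := 0) hom (by simpa using hR1 1)
    (fun i hi => by simpa [hi] using hR1 i) 0
  have hTtop := coeff_coeff_aeval (P := T) (j := 1) (κ := 0) hom (by simpa using hT1 1)
    (fun i hi => by simpa [hi] using hT1 i) 0
  have hR2 : ((R 1 ^ a).coeff 0).coeff (a + 0 * 0) = 1 := by
    have : (R 1 ^ a).coeff 0 = (X - 1) ^ a := by simp [R, coeff_zero_eq_eval_zero]
    have h1 : (X - 1 : S[X]).natDegree ≤ 1 := by compute_degree
    have h2 := coeff_pow_of_natDegree_le (m := a) h1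
    rw [mul_one] at h2
    simp [this, h2, coeff_one]
  have hT2 : ((T 1 ^ a).coeff 0).coeff (a + 0 * 0) = -1 := by
    have : (T 1 ^ a).coeff 0 = (-(X + 1)) ^ a := by simp [T, coeff_zero_eq_eval_zero]
    have h1 : (-(X + 1) : S[X]).natDegree ≤ 1 := by compute_degree
    have h2 := coeff_pow_of_natDegree_le (m := a) h1
    rw [mul_one] at h2
    rw [this, zero_mul, add_zero, h2, coeff_neg, coeff_add, coeff_X_one, coeff_one,
      if_neg one_ne_zero, add_zero, ha.neg_one_pow]
  rw [heq, hTtop, hR2, hT2, mul_one, mul_neg_one, neg_eq_iff_add_eq_zero, ← two_mul] at hRtop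
  refine (mul_eq_zero.1 hRtop).resolve_left fun h => ?_
  have hdvd := (CharP.cast_eq_zero_iff S p 2).1 (by exact_mod_cast h)
  have := Nat.le_of_dvd two_pos hdvd
  have := ha.pos
  omega

end UnipotentShift

/-! ### A functional detecting an indecomposable transfer -/

section Frame

open Polynomial

lemma algHom_congr {F V A : Type*} [Field F] [AddCommGroup V] [Module F V] [CommRing A]
    [Algebra F A] (f g : CoordRing F V →ₐ[F] A) (h : ∀ φ, f (coord φ) = g (coord φ))
    (x : CoordRing F V) : f x = g x :=
  DFunLike.congr_fun (SymmetricAlgebra.algHom_ext (LinearMap.ext h)) x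

/-- The value of an invariant at a point does not change when the point is moved by the group. -/
lemma lift_comp_dual_eq {F G V A : Type*} [Field F] [Group G] [AddCommGroup V] [Module F V]
    [CommRing A] [Algebra F A] (ρ : Representation F G V) (q : Module.Dual F V →ₗ[F] A) (g : G)
    (f : CoordRing F V) :
    SymmetricAlgebra.lift (q ∘ₗ ρ.dual g) f = SymmetricAlgebra.lift q (action ρ g f) := by
  refine algHom_congr (SymmetricAlgebra.lift (q ∘ₗ ρ.dual g))
    ((SymmetricAlgebra.lift q).comp (action ρ g)) (fun φ => ?_) f
  simp [action]

/-- Vectors in `V` spanning a copy of `m V_2 + V_{n + 2}` (for the generator `σ⁻¹`): `m` chains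
`upper i, lower i` of length two and a chain `chain 0, …, chain (n + 1)`, together with linear
functionals `η i`, `ζ`, `υ` which on these vectors take the values of the coordinates dual to
`lower i`, to the last and to the last but one vector of the long chain, as far as they are
needed. -/
structure JordanFrame {F V : Type*} [Field F] [AddCommGroup V] [Module F V] {p : ℕ}
    (ρ : Representation F (Cyc p) V) (m n : ℕ) where
  upper : Fin m → V
  lower : Fin m → V
  chain : Fin (n + 2) → V
  η : Fin m → Module.Dual F V
  ζ : Module.Dual F V
  υ : Module.Dual F V
  upper_eq : ∀ i, ρ (sigma p)⁻¹ (upper i) = upper i + lower i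
  lower_eq : ∀ i, ρ (sigma p)⁻¹ (lower i) = lower i
  chain_last : ρ (sigma p)⁻¹ (chain (Fin.last (n + 1))) = chain (Fin.last (n + 1))
  chain_castSucc : ∀ j : Fin (n + 1),
    ρ (sigma p)⁻¹ (chain j.castSucc) = chain j.castSucc + chain j.succ
  η_lower : ∀ i j, η i (lower j) = if j = i then 1 else 0
  η_chain : ∀ i, η i (chain (Fin.last n).castSucc) = 0 ∧ η i (chain (Fin.last (n + 1))) = 0
  ζ_lower : ∀ i, ζ (lower i) = 0
  ζ_chain : ζ (chain (Fin.last n).castSucc) = 0 ∧ ζ (chain (Fin.last (n + 1))) = 1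
  υ_lower : ∀ i, υ (lower i) = 0
  υ_chain : υ (chain (Fin.last n).castSucc) = 1 ∧ υ (chain (Fin.last (n + 1))) = 0

namespace JordanFrame

variable {F V : Type*} [Field F] [AddCommGroup V] [Module F V] {p m n : ℕ}
  {ρ : Representation F (Cyc p) V} (D : JordanFrame ρ m n)

/-- The generic point `∑ s_i • lower i + ∑ X_j • chain j`. -/
noncomputable def genericPoint :
    Module.Dual F V →ₗ[F] MvPolynomial (Fin (n + 2)) (MvPolynomial (Fin m) F) :=
  ∑ i, (Module.Dual.eval F V (D.lower i)).smulRight (MvPolynomial.C (MvPolynomial.X i)) +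
    ∑ j, (Module.Dual.eval F V (D.chain j)).smulRight (MvPolynomial.X j)

/-- The point `∑ s_i • lower i + u • chain n`, where `chain n` is the last but one vector of the
long chain. -/
noncomputable def linePoint : Module.Dual F V →ₗ[F] (MvPolynomial (Fin m) F)[X] :=
  ∑ i, (Module.Dual.eval F V (D.lower i)).smulRight (C (MvPolynomial.X i)) +
    (Module.Dual.eval F V (D.chain (Fin.last n).castSucc)).smulRight X

lemma genericPoint_apply (φ : Module.Dual F V) :
    D.genericPoint φ = ∑ i, φ (D.lower i) • MvPolynomial.C (MvPolynomial.X i) +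
      ∑ j, φ (D.chain j) • MvPolynomial.X j := by
  simp [genericPoint]

lemma linePoint_apply (φ : Module.Dual F V) :
    D.linePoint φ = ∑ i, φ (D.lower i) • C (MvPolynomial.X i) +
      φ (D.chain (Fin.last n).castSucc) • (X : (MvPolynomial (Fin m) F)[X]) := by
  simp [linePoint]

lemma unipotentShift_genericPoint {f : CoordRing F V} (hf : f ∈ invariantRing ρ) :
    unipotentShift (MvPolynomial (Fin m) F) (n + 1) (SymmetricAlgebra.lift D.genericPoint f) =
      SymmetricAlgebra.lift D.genericPoint f := by
  conv_rhs => rw [← hf (sigma p), ← lift_comp_dual_eq]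
  refine algHom_congr (((unipotentShift (MvPolynomial (Fin m) F) (n + 1)).restrictScalars F).comp
    (SymmetricAlgebra.lift D.genericPoint))
    (SymmetricAlgebra.lift (D.genericPoint ∘ₗ ρ.dual (sigma p))) (fun φ => ?_) f
  have h1 (i : Fin m) : unipotentShift (MvPolynomial (Fin m) F) (n + 1)
      (φ (D.lower i) • MvPolynomial.C (MvPolynomial.X i)) =
        φ (D.lower i) • MvPolynomial.C (MvPolynomial.X i) := by
    rw [← AlgHom.restrictScalars_apply F, map_smul, AlgHom.restrictScalars_apply]
    congr 1
    exact (unipotentShift (MvPolynomial (Fin m) F) (n + 1)).commutes _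
  have h2 (j : Fin (n + 2)) : unipotentShift (MvPolynomial (Fin m) F) (n + 1)
      (φ (D.chain j) • MvPolynomial.X j) =
        φ (D.chain j) • unipotentShift (MvPolynomial (Fin m) F) (n + 1) (MvPolynomial.X j) := by
    rw [← AlgHom.restrictScalars_apply F, map_smul, AlgHom.restrictScalars_apply]
  have h3 (v : V) : ρ.dual (sigma p) φ v = φ (ρ (sigma p)⁻¹ v) := by
    simp [Representation.dual_apply, Module.Dual.transpose_apply]
  simp only [LinearMap.comp_apply, AlgHom.comp_apply,
    AlgHom.restrictScalars_apply, SymmetricAlgebra.lift_ι_apply, genericPoint_apply, map_add,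
    map_sum, h1, h2, h3, D.lower_eq]
  congr 1
  rw [Fin.sum_univ_succ, Fin.sum_univ_castSucc (n := n + 1)]
  simp only [D.chain_last, D.chain_castSucc, map_add, add_smul, Finset.sum_add_distrib]
  simp only [unipotentShift, MvPolynomial.aeval_X, Fin.cons_zero, Fin.cons_succ, smul_add,
    Finset.sum_add_distrib]
  have e1 := Fin.sum_univ_succ (n := n + 1) fun j => φ (D.chain j) •
    (MvPolynomial.X j : MvPolynomial (Fin (n + 2)) (MvPolynomial (Fin m) F))
  rw [Fin.sum_univ_castSucc] at e1
  linear_combination -e1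

lemma coeff_aeval_single {S σ : Type*} [CommRing S] [DecidableEq σ] (j : σ)
    (f : MvPolynomial σ S) (a : ℕ) :
    (MvPolynomial.aeval (Pi.single j (X : S[X])) f).coeff a = f.coeff (Finsupp.single j a) := by
  induction f using MvPolynomial.induction_on' with
  | monomial d s =>
    rw [MvPolynomial.aeval_monomial, MvPolynomial.coeff_monomial, ← C_eq_algebraMap, coeff_C_mul]
    by_cases hd : d = Finsupp.single j (d j)
    · rw [hd, Finsupp.prod_single_index (by simp)]
      have : Finsupp.single j (d j) = Finsupp.single j a ↔ a = d j :=
        ⟨fun h => (Finsupp.single_injective j h).symm, fun h => h ▸ rfl⟩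
      simp [coeff_X_pow, this]
    · have : ∃ i ∈ d.support, i ≠ j := by
        by_contra! h
        refine hd (Finsupp.ext fun i => ?_)
        rcases eq_or_ne i j with rfl | hi
        · simp
        · rw [Finsupp.single_eq_of_ne hi]
          exact Finsupp.notMem_support_iff.1 fun hm => hi (h i hm)
      obtain ⟨i, hi, hij⟩ := this
      rw [Finsupp.prod, Finset.prod_eq_zero hi, coeff_zero, mul_zero, if_neg]
      · rintro rfl
        simp at hd
      · rw [Pi.single_eq_of_ne hij, zero_pow (Finsupp.mem_support_iff.1 hi)]
  | add f g hf hg => rw [map_add, coeff_add, hf, hg, MvPolynomial.coeff_add]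

lemma coeff_linePoint (f : CoordRing F V) (a : ℕ) :
    (SymmetricAlgebra.lift D.linePoint f).coeff a =
      (SymmetricAlgebra.lift D.genericPoint f).coeff
        (Finsupp.single (Fin.last n).castSucc a) := by
  rw [← coeff_aeval_single]
  refine congrArg (fun q : (MvPolynomial (Fin m) F)[X] => q.coeff a)
    (algHom_congr (SymmetricAlgebra.lift D.linePoint) (((MvPolynomial.aeval
      (Pi.single (Fin.last n).castSucc (X : (MvPolynomial (Fin m) F)[X]))).restrictScalars F).comp
        (SymmetricAlgebra.lift D.genericPoint)) (fun φ => ?_) f)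
  rw [SymmetricAlgebra.lift_ι_apply, AlgHom.comp_apply, SymmetricAlgebra.lift_ι_apply,
    linePoint_apply, genericPoint_apply, map_add, map_sum, map_sum,
    Finset.sum_eq_single_of_mem (Fin.last n).castSucc (Finset.mem_univ _)]
  · simp only [map_smul, AlgHom.restrictScalars_apply, MvPolynomial.aeval_X, Pi.single_eq_same,
      MvPolynomial.aeval_C]
    rfl
  · intro j _ hj
    rw [map_smul, AlgHom.restrictScalars_apply, MvPolynomial.aeval_X, Pi.single_eq_of_ne hj,
      smul_zero]

/-- Modulo `ε²`, translating the `i`-th coordinate by `ε` changes a polynomial by its `i`-th partial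
derivative; so the restriction of an invariant to the span of the `lower j` has vanishing partial
derivatives. -/
lemma pderiv_coeff_zero_linePoint {f : CoordRing F V} (hf : f ∈ invariantRing ρ) (i : Fin m) :
    MvPolynomial.pderiv i ((SymmetricAlgebra.lift D.linePoint f).coeff 0) = 0 := by
  -- the point `∑ s_j • lower j + ε • upper i`, whose translate is obtained by `s_i ↦ s_i + ε`
  let q : Module.Dual F V →ₗ[F] (MvPolynomial (Fin m) F)[X] :=
    ∑ j, (Module.Dual.eval F V (D.lower j)).smulRight (C (MvPolynomial.X j)) +
      (Module.Dual.eval F V (D.upper i)).smulRight X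
  have hq (φ : Module.Dual F V) : q φ = ∑ j, φ (D.lower j) • C (MvPolynomial.X j) +
      φ (D.upper i) • (X : (MvPolynomial (Fin m) F)[X]) := by simp [q]
  have hdual (φ : Module.Dual F V) : q (ρ.dual (sigma p) φ) = q φ + φ (D.lower i) • X := by
    have h3 (v : V) : ρ.dual (sigma p) φ v = φ (ρ (sigma p)⁻¹ v) := by
      simp [Representation.dual_apply, Module.Dual.transpose_apply]
    simp only [hq, h3, D.lower_eq, D.upper_eq, map_add, add_smul]
    ring
  have key (x : CoordRing F V) :
      (SymmetricAlgebra.lift q x).coeff 0 = (SymmetricAlgebra.lift D.linePoint x).coeff 0 ∧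
      (SymmetricAlgebra.lift (q ∘ₗ ρ.dual (sigma p)) x).coeff 0 =
        (SymmetricAlgebra.lift q x).coeff 0 ∧
      (SymmetricAlgebra.lift (q ∘ₗ ρ.dual (sigma p)) x).coeff 1 =
        (SymmetricAlgebra.lift q x).coeff 1 +
          MvPolynomial.pderiv i ((SymmetricAlgebra.lift q x).coeff 0) := by
    induction x using SymmetricAlgebra.induction with
    | algebraMap r =>
      simp only [AlgHom.commutes, Polynomial.algebraMap_apply, coeff_C]
      simp
    | ι φ =>
      simp only [SymmetricAlgebra.lift_ι_apply, LinearMap.comp_apply, hdual]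
      refine ⟨?_, ?_, ?_⟩
      · simp [hq, linePoint_apply]
      · simp
      · simp [hq, coeff_C, MvPolynomial.pderiv_X, Pi.single_apply]
    | mul x y hx hy =>
      simp only [map_mul, mul_coeff_zero, mul_coeff_one, hx.1, hx.2.1, hx.2.2, hy.1, hy.2.1,
        hy.2.2, MvPolynomial.pderiv_mul]
      refine ⟨trivial, trivial, by ring⟩
    | add x y hx hy =>
      simp only [map_add, coeff_add, hx.1, hx.2.1, hx.2.2, hy.1, hy.2.1, hy.2.2]
      refine ⟨trivial, trivial, by ring⟩
  have h := (key f).2.2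
  rw [lift_comp_dual_eq, hf, (key f).1] at h
  exact left_eq_add.1 h

/-- Exponent vectors with entries below `p` do not occur in the restriction of an invariant without
constant term to the span of the `lower j`. -/
lemma coeff_coeff_zero_linePoint [CharP F p] {f : CoordRing F V} (hf : f ∈ invariantRing ρ)
    (h0 : SymmetricAlgebra.algebraMapInv f = 0) {A : Fin m →₀ ℕ} (hA : ∀ i, A i < p) :
    ((SymmetricAlgebra.lift D.linePoint f).coeff 0).coeff A = 0 := by
  by_cases hA0 : A = 0
  · have : (SymmetricAlgebra.algebraMapInv f : F) =
        ((SymmetricAlgebra.lift D.linePoint f).coeff 0).coeff 0 := by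
      have h := algHom_congr SymmetricAlgebra.algebraMapInv
        (((MvPolynomial.aeval (fun _ => 0)).comp
          ((Polynomial.aeval (0 : MvPolynomial (Fin m) F)).restrictScalars F)).comp
            (SymmetricAlgebra.lift D.linePoint)) (fun φ => ?_) f
      · rw [h, coeff_zero_eq_aeval_zero]
        simp [MvPolynomial.constantCoeff_eq]
      · simp [linePoint_apply, SymmetricAlgebra.algebraMapInv_ι, eval_finsetSum]
    rw [hA0, ← this, h0]
  · obtain ⟨i, hi⟩ := Finsupp.ne_iff.1 hA0
    have hle : Finsupp.single i 1 ≤ A := by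
      rw [Finsupp.single_le_iff]
      exact Nat.one_le_iff_ne_zero.2 hi
    have h := congrArg (MvPolynomial.coeff (A - Finsupp.single i 1))
      (D.pderiv_coeff_zero_linePoint hf i)
    rw [MvPolynomial.coeff_pderiv, tsub_add_cancel_of_le hle, MvPolynomial.coeff_zero] at h
    refine (mul_eq_zero.1 h).resolve_right fun h1 => ?_
    have h2 : ((A i : ℕ) : F) = 0 := by
      rw [← h1]
      have : A i = (A - Finsupp.single i 1 : Fin m →₀ ℕ) i + 1 := by
        simp only [Finsupp.coe_tsub, Pi.sub_apply, Finsupp.single_eq_same]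
        have : A i ≠ 0 := hi
        omega
      rw [this]
      push_cast
      rfl
    have := Nat.le_of_dvd (Nat.pos_of_ne_zero hi) ((CharP.cast_eq_zero_iff F p _).1 h2)
    have := hA i
    omega

/-- `linePoint` respects degrees. -/
lemma degree_add_eq_of_coeff_ne_zero {d : ℕ} {f : CoordRing F V}
    (hf : f ∈ homogeneousPart F V d) {a : ℕ} {A : Fin m →₀ ℕ}
    (h : ((SymmetricAlgebra.lift D.linePoint f).coeff a).coeff A ≠ 0) :
    Finsupp.degree A + a = d := by
  induction hf using Submodule.pow_induction_on_left' generalizing a A with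
  | algebraMap r =>
    rw [AlgHom.commutes, Polynomial.algebraMap_apply, coeff_C] at h
    split_ifs at h with ha
    · rw [MvPolynomial.algebraMap_eq, MvPolynomial.coeff_C] at h
      split_ifs at h with hA
      · simp [ha, ← hA]
      · exact absurd rfl h
    · simp at h
  | add x y i hx hy ihx ihy =>
    rw [map_add, coeff_add, MvPolynomial.coeff_add] at h
    by_cases h1 : ((SymmetricAlgebra.lift D.linePoint x).coeff a).coeff A = 0
    · rw [h1, zero_add] at h
      exact ihy h
    · exact ihx h1
  | mem_mul l hl i x hx ih =>
    obtain ⟨φ, rfl⟩ := hl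
    rw [map_mul, SymmetricAlgebra.lift_ι_apply, linePoint_apply, add_mul, Finset.sum_mul,
      coeff_add, finsetSum_coeff, MvPolynomial.coeff_add, MvPolynomial.coeff_sum] at h
    by_cases h1 : (((φ (D.chain (Fin.last n).castSucc) •
        (X : (MvPolynomial (Fin m) F)[X])) * SymmetricAlgebra.lift D.linePoint x).coeff a).coeff A
          = 0
    · rw [h1, add_zero] at h
      obtain ⟨j, _, hj⟩ := Finset.exists_ne_zero_of_sum_ne_zero h
      rw [smul_mul_assoc, coeff_smul, coeff_C_mul, MvPolynomial.coeff_smul,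
        MvPolynomial.coeff_X_mul'] at hj
      split_ifs at hj with hjA
      · have h2 := ih (right_ne_zero_of_mul hj)
        have h3 : Finsupp.single j 1 ≤ A := by
          rw [Finsupp.single_le_iff]
          exact Nat.one_le_iff_ne_zero.2 (Finsupp.mem_support_iff.1 hjA)
        have h4 := congrArg Finsupp.degree (tsub_add_cancel_of_le h3)
        rw [map_add, Finsupp.degree_single] at h4
        omega
      · simp at hj
    · rcases a with _ | a
      · simp at h1
      · rw [smul_mul_assoc, coeff_smul, coeff_X_mul, MvPolynomial.coeff_smul] at h1
        have := ih (right_ne_zero_of_mul h1)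
        omega

/-- The coefficient of `(s_1 ⋯ s_m) ^ (p - 1) u ^ N` in the restriction of `f` to the points
`linePoint`. -/
noncomputable def topCoeff (N : ℕ) : CoordRing F V →ₗ[F] F :=
  MvPolynomial.lcoeff F (Finsupp.equivFunOnFinite.symm fun _ : Fin m => p - 1) ∘ₗ
    (Polynomial.lcoeff (MvPolynomial (Fin m) F) N).restrictScalars F ∘ₗ
      (SymmetricAlgebra.lift D.linePoint).toLinearMap

lemma topCoeff_apply (N : ℕ) (f : CoordRing F V) :
    D.topCoeff N f = ((SymmetricAlgebra.lift D.linePoint f).coeff N).coeff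
      (Finsupp.equivFunOnFinite.symm fun _ : Fin m => p - 1) := rfl

/-- If in every splitting of `N` into two positive parts, one part is a power of `u` that no
invariant contains, then `topCoeff N` vanishes on decomposable invariants. -/
lemma topCoeff_eq_zero_of_mem_sq [Fact p.Prime] [CharP F p] {N : ℕ}
    (hN : ∀ a b, 0 < a → 0 < b → a + b = N →
      (∀ f ∈ invariantRing ρ, (SymmetricAlgebra.lift D.linePoint f).coeff a = 0) ∨
      (∀ f ∈ invariantRing ρ, (SymmetricAlgebra.lift D.linePoint f).coeff b = 0))
    {f : invariantRing ρ} (hf : f ∈ positiveIdeal ρ ^ 2) : D.topCoeff N f = 0 := by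
  rw [pow_two] at hf
  induction hf using Submodule.mul_induction_on' with
  | add x _ y _ hx hy => rw [Subalgebra.coe_add, map_add, hx, hy, add_zero]
  | mem_mul_mem x hx y hy =>
    rw [topCoeff_apply, Subalgebra.coe_mul, map_mul, coeff_mul, MvPolynomial.coeff_sum]
    refine Finset.sum_eq_zero fun ab hab => ?_
    rw [MvPolynomial.coeff_mul]
    refine Finset.sum_eq_zero fun AB hAB => ?_
    have hab := Finset.HasAntidiagonal.mem_antidiagonal.1 hab
    have hAB := Finset.HasAntidiagonal.mem_antidiagonal.1 hAB
    have hp := (Fact.out : p.Prime).pos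
    have hi (i : Fin m) : AB.1 i + AB.2 i = p - 1 := by
      simpa using DFunLike.congr_fun hAB i
    rcases Nat.eq_zero_or_pos ab.1 with ha | ha
    · rw [ha, D.coeff_coeff_zero_linePoint x.2 hx (fun i => by have := hi i; omega), zero_mul]
    rcases Nat.eq_zero_or_pos ab.2 with hb | hb
    · rw [hb, D.coeff_coeff_zero_linePoint y.2 hy (fun i => by have := hi i; omega), mul_zero]
    rcases hN _ _ ha hb hab with h | h
    · rw [h x x.2, MvPolynomial.coeff_zero, zero_mul]
    · rw [h y y.2, MvPolynomial.coeff_zero, mul_zero]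

lemma topCoeff_eq_zero_of_ne {N d : ℕ} (hd : d ≠ m * (p - 1) + N) {f : CoordRing F V}
    (hf : f ∈ homogeneousPart F V d) : D.topCoeff N f = 0 := by
  by_contra h
  refine hd (D.degree_add_eq_of_coeff_ne_zero hf h ▸ ?_)
  simp [Finsupp.degree_eq_sum]

lemma sigma_inv_pow_chain (k : ℕ) :
    ρ ((sigma p)⁻¹ ^ k) (D.chain (Fin.last n).castSucc) =
      D.chain (Fin.last n).castSucc + k • D.chain (Fin.last (n + 1)) := by
  induction k with
  | zero => simp
  | succ k ih =>
    rw [pow_succ', map_mul, Module.End.mul_apply, ih, map_add, map_nsmul, D.chain_last,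
      D.chain_castSucc, Fin.succ_last, succ_nsmul]
    abel

lemma sigma_inv_pow_lower (k : ℕ) (i : Fin m) :
    ρ ((sigma p)⁻¹ ^ k) (D.lower i) = D.lower i := by
  induction k with
  | zero => simp
  | succ k ih => rw [pow_succ', map_mul, Module.End.mul_apply, ih, D.lower_eq]

/-- The element `(η_1 ⋯ η_m ζ) ^ (p - 1) υ ^ e`, whose transfer turns out to be indecomposable. -/
noncomputable def monomial (e : ℕ) : CoordRing F V :=
  ((∏ i, coord (D.η i)) * coord D.ζ) ^ (p - 1) * coord D.υ ^ e

/-- Translating the point by `σ⁻ᶜ` adds `c` times the last vector of the chain, so the transfer is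
evaluated through the power sum `∑ c ^ (p - 1) = -1` over `𝔽_p`. -/
lemma topCoeff_transfer [Fact p.Prime] [CharP F p] (e : ℕ) :
    D.topCoeff (p - 1 + e) (transfer ρ (D.monomial e) : CoordRing F V) = -1 := by
  have key (c : ZMod p) : D.topCoeff (p - 1 + e)
      (action ρ (Multiplicative.ofAdd c) (D.monomial e)) = (c.val : F) ^ (p - 1) := by
    have hc : (Multiplicative.ofAdd c : Cyc p)⁻¹ = (sigma p)⁻¹ ^ c.val := by
      rw [inv_pow, inv_inj, sigma, ← ofAdd_nsmul, nsmul_eq_mul, mul_one, ZMod.natCast_zmod_val]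
    have hval (φ : Module.Dual F V) :
        D.linePoint (ρ.dual (Multiplicative.ofAdd c) φ) = ∑ i, φ (D.lower i) •
          C (MvPolynomial.X i) + (φ (D.chain (Fin.last n).castSucc) +
            (c.val : F) * φ (D.chain (Fin.last (n + 1)))) • (X : (MvPolynomial (Fin m) F)[X]) := by
      have h3 (v : V) : ρ.dual (Multiplicative.ofAdd c) φ v = φ (ρ ((sigma p)⁻¹ ^ c.val) v) := by
        rw [← hc]
        simp [Representation.dual_apply, Module.Dual.transpose_apply]
      simp only [linePoint_apply, h3, D.sigma_inv_pow_lower, D.sigma_inv_pow_chain, map_add,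
        map_nsmul, nsmul_eq_mul]
    rw [topCoeff_apply, ← lift_comp_dual_eq]
    simp only [monomial, map_mul, map_pow, map_prod, SymmetricAlgebra.lift_ι_apply,
      LinearMap.comp_apply, hval, D.η_lower, D.ζ_lower, D.υ_lower, D.η_chain, D.ζ_chain,
      D.υ_chain]
    have : ((∏ i : Fin m, (∑ j : Fin m, (if j = i then (1 : F) else 0) •
        C (MvPolynomial.X j) + (0 + (c.val : F) * 0) • (X : (MvPolynomial (Fin m) F)[X]))) *
        (∑ j : Fin m, (0 : F) • C (MvPolynomial.X j) + (0 + (c.val : F) * 1) • X)) ^ (p - 1) *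
        (∑ j : Fin m, (0 : F) • C (MvPolynomial.X j) + (1 + (c.val : F) * 0) • X) ^ e =
        C (MvPolynomial.monomial (Finsupp.equivFunOnFinite.symm fun _ : Fin m => p - 1)
          ((c.val : F) ^ (p - 1))) * X ^ (p - 1 + e) := by
      rw [MvPolynomial.monomial_eq, Finsupp.prod_fintype _ _ (fun i => pow_zero _), C_mul,
        map_prod]
      simp only [ite_smul, one_smul, zero_smul, Finset.sum_ite_eq', Finset.mem_univ, if_true,
        mul_zero, add_zero, mul_one, Finset.sum_const_zero, zero_add,
        Finsupp.equivFunOnFinite_symm_apply_apply, map_pow, Finset.prod_pow]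
      rw [Algebra.smul_def, Polynomial.algebraMap_apply, MvPolynomial.algebraMap_eq, pow_add]
      ring
    rw [this, coeff_C_mul_X_pow, if_pos rfl, MvPolynomial.coeff_monomial, if_pos rfl]
  have hsum : ∑ c : ZMod p, (c.val : F) ^ (p - 1) = -1 := by
    have hp := (Fact.out : p.Prime).two_le
    have h1 (c : ZMod p) : (c.val : F) ^ (p - 1) = 1 - if c = 0 then 1 else 0 := by
      split_ifs with h
      · rw [h, ZMod.val_zero, Nat.cast_zero, zero_pow (by omega), sub_self]
      · rw [ZMod.natCast_val, ← ZMod.castHom_apply (R := F) (h := dvd_refl p), ← map_pow,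
          ZMod.pow_card_sub_one_eq_one h, map_one, sub_zero]
    simp_rw [h1]
    simp
  rw [transfer, map_sum, ← hsum]
  exact Fintype.sum_equiv Multiplicative.toAdd _ _ fun g => key g.toAdd

end JordanFrame

end Frame

/-! ### Bounding the Noether number from below -/

section Bound

open Polynomial

namespace JordanFrame

variable {F V : Type*} [Field F] [AddCommGroup V] [Module F V] {p m n : ℕ}
  {ρ : Representation F (Cyc p) V} (D : JordanFrame ρ m n)

/-- Invariants of degree smaller than that of the transfer, and products of invariants without
constant term, are killed by `topCoeff`; the transfer is not. -/
lemma le_of_generatedInDegree [Fact p.Prime] [CharP F p] {e : ℕ} (he : 0 < e)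
    (hsq : ∀ f : invariantRing ρ, f ∈ positiveIdeal ρ ^ 2 → D.topCoeff (p - 1 + e) f = 0)
    {d : ℕ} (hd : GeneratedInDegree ρ d) : m * (p - 1) + (p - 1 + e) ≤ d := by
  by_contra! hlt
  have hconst (c : F) : D.topCoeff (p - 1 + e) (algebraMap F (CoordRing F V) c) = 0 :=
    D.topCoeff_eq_zero_of_ne (d := 0) (he.trans_le (by omega)).ne (by
      rw [homogeneousPart, pow_zero]
      exact Submodule.algebraMap_mem c)
  have key (x : CoordRing F V) (hx : x ∈ invariantRing ρ) : D.topCoeff (p - 1 + e) x = 0 := by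
    rw [← hd] at hx
    induction hx using Algebra.adjoin_induction with
    | mem x hx =>
      obtain ⟨-, r, hr, hxr⟩ := hx
      exact D.topCoeff_eq_zero_of_ne (by omega) hxr
    | algebraMap c => exact hconst c
    | add x y _ _ hx hy => rw [map_add, hx, hy, add_zero]
    | mul x y hxm hym hx hy =>
      rw [hd] at hxm hym
      -- subtracting the constant terms reduces to a product in the square of the positive ideal
      have hsub (z : CoordRing F V) (hz : z ∈ invariantRing ρ) :
          ∃ w : invariantRing ρ, w ∈ positiveIdeal ρ ∧
            z = w + algebraMap F _ (SymmetricAlgebra.algebraMapInv z) := by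
        refine ⟨⟨z - algebraMap F _ (SymmetricAlgebra.algebraMapInv z),
          sub_mem hz (Subalgebra.algebraMap_mem _ _)⟩, ?_, by simp⟩
        rw [positiveIdeal, RingHom.mem_ker]
        simp
      obtain ⟨x', hx', ex⟩ := hsub x hxm
      obtain ⟨y', hy', ey⟩ := hsub y hym
      set a : F := SymmetricAlgebra.algebraMapInv x
      set b : F := SymmetricAlgebra.algebraMapInv y
      have hxy : x * y = (x' * y' : invariantRing ρ) + a • y + b • x -
          algebraMap F _ (a * b) := by
        rw [Subalgebra.coe_mul, Algebra.smul_def, Algebra.smul_def, map_mul,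
          eq_sub_of_add_eq ex.symm, eq_sub_of_add_eq ey.symm]
        ring
      rw [hxy, map_sub, map_add, map_add, map_smul, map_smul, hx, hy, hconst,
        hsq _ (pow_two (positiveIdeal ρ) ▸ Ideal.mul_mem_mul hx' hy')]
      simp
  have h := D.topCoeff_transfer e
  rw [key _ (transfer ρ (D.monomial e)).2] at h
  exact one_ne_zero (neg_eq_zero.1 h.symm)

lemma isIndecomposable_transfer [Fact p.Prime] [CharP F p] {e : ℕ} (he : 0 < e)
    (hsq : ∀ f : invariantRing ρ, f ∈ positiveIdeal ρ ^ 2 → D.topCoeff (p - 1 + e) f = 0) :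
    IsIndecomposable ρ (transfer ρ (D.monomial e)) := by
  constructor
  · rw [positiveIdeal, RingHom.mem_ker]
    change SymmetricAlgebra.algebraMapInv (∑ g, action ρ g (D.monomial e)) = 0
    rw [map_sum]
    refine Finset.sum_eq_zero fun g _ => ?_
    have h (x : CoordRing F V) : SymmetricAlgebra.algebraMapInv (action ρ g x) =
        SymmetricAlgebra.algebraMapInv x :=
      algHom_congr (SymmetricAlgebra.algebraMapInv.comp (action ρ g))
        SymmetricAlgebra.algebraMapInv (fun φ => by
          simp [action, SymmetricAlgebra.algebraMapInv_ι]) x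
    rw [h, monomial, map_mul, map_pow _ (coord D.υ), SymmetricAlgebra.algebraMapInv_ι,
      zero_pow he.ne', mul_zero]
  · intro h
    have h1 := D.topCoeff_transfer e
    rw [hsq _ h] at h1
    exact one_ne_zero (neg_eq_zero.1 h1.symm)

end JordanFrame

namespace JordanFrame

variable {F V : Type*} [Field F] [AddCommGroup V] [Module F V] {p m : ℕ} [Fact p.Prime] [CharP F p]
  {ρ : Representation F (Cyc p) V}

/-- For the four-dimensional block, one of two positive parts of `2p - 3` is less than `p - 1`. -/
lemma topCoeff_sq_of_four (D : JordanFrame ρ m 2) (hp : 4 ≤ p) (f : invariantRing ρ)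
    (hf : f ∈ positiveIdeal ρ ^ 2) : D.topCoeff (p - 1 + (p - 2)) f = 0 := by
  have h (a : ℕ) (ha : 0 < a) (hap : a + 1 < p) (f : CoordRing F V) (hf : f ∈ invariantRing ρ) :
      (SymmetricAlgebra.lift D.linePoint f).coeff a = 0 := by
    rw [coeff_linePoint]
    exact coeff_eq_zero_of_unipotentShift_three p (D.unipotentShift_genericPoint hf) ha hap
  refine D.topCoeff_eq_zero_of_mem_sq (fun a b ha hb hab => ?_) hf
  rcases lt_or_ge (a + 1) p with h1 | h1
  · exact .inl (h a ha h1)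
  · exact .inr (h b hb (by omega))

/-- For the three-dimensional block, one of two positive parts of the odd number `p` is odd. -/
lemma topCoeff_sq_of_three (D : JordanFrame ρ m 1) (hp : 3 ≤ p) (f : invariantRing ρ)
    (hf : f ∈ positiveIdeal ρ ^ 2) : D.topCoeff (p - 1 + 1) f = 0 := by
  have h (a : ℕ) (ha : Odd a) (hap : a < p) (f : CoordRing F V) (hf : f ∈ invariantRing ρ) :
      (SymmetricAlgebra.lift D.linePoint f).coeff a = 0 := by
    rw [coeff_linePoint]
    exact coeff_eq_zero_of_unipotentShift_two p (by omega) (D.unipotentShift_genericPoint hf) ha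
      hap
  refine D.topCoeff_eq_zero_of_mem_sq (fun a b ha hb hab => ?_) hf
  have hodd : Odd p := (Fact.out : p.Prime).odd_of_ne_two (by omega)
  rcases Nat.even_or_odd a with h1 | h1
  · refine .inr (h b ?_ (by omega))
    rw [show p = a + b by omega, Nat.odd_add] at hodd
    by_contra hb'
    exact absurd (hodd.2 (Nat.not_odd_iff_even.1 hb')) (Nat.not_odd_iff_even.2 h1)
  · exact .inl (h a h1 (by omega))

end JordanFrame

end Bound

/-! ### Finite generation in bounded degree -/

section FiniteGeneration

open Polynomial

variable {F G V : Type*} [Field F] [Group G] [AddCommGroup V] [Module F V]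

/-- The algebra map `F[V] → F[V][t]` with `φ ↦ φ t`; its coefficients are the homogeneous
components. -/
noncomputable def scaling (F V : Type*) [Field F] [AddCommGroup V] [Module F V] :
    CoordRing F V →ₐ[F] (CoordRing F V)[X] :=
  SymmetricAlgebra.lift
    ((LinearMap.mulRight F (X : (CoordRing F V)[X])) ∘ₗ (CAlgHom (R := F)).toLinearMap ∘ₗ
      SymmetricAlgebra.ι F (Module.Dual F V))

lemma scaling_coord (φ : Module.Dual F V) : scaling F V (coord φ) = C (coord φ) * X := by
  simp [scaling]

lemma eval_one_scaling (f : CoordRing F V) : (scaling F V f).eval 1 = f := by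
  have := algHom_congr (((Polynomial.aeval (1 : CoordRing F V)).restrictScalars F).comp
    (scaling F V)) (AlgHom.id F _) (fun φ => by simp [scaling_coord]) f
  simpa [Polynomial.coe_aeval_eq_eval] using this

lemma coeff_scaling_mem (f : CoordRing F V) (i : ℕ) :
    (scaling F V f).coeff i ∈ homogeneousPart F V i := by
  induction f using SymmetricAlgebra.induction generalizing i with
  | algebraMap r =>
    rw [AlgHom.commutes, Polynomial.algebraMap_apply, coeff_C]
    split_ifs with hi
    · rw [hi, homogeneousPart, pow_zero]
      exact Submodule.algebraMap_mem r
    · exact zero_mem _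
  | ι φ =>
    rw [scaling_coord, coeff_C_mul, coeff_X]
    split_ifs with hi
    · rw [← hi, homogeneousPart, pow_one, mul_one]
      exact LinearMap.mem_range_self _ φ
    · rw [mul_zero]
      exact zero_mem _
  | mul x y hx hy =>
    rw [map_mul, coeff_mul]
    refine sum_mem fun ab hab => ?_
    rw [← Finset.HasAntidiagonal.mem_antidiagonal.1 hab, homogeneousPart, pow_add]
    exact Submodule.mul_mem_mul (hx _) (hy _)
  | add x y hx hy =>
    rw [map_add, coeff_add]
    exact add_mem (hx i) (hy i)

lemma coeff_scaling_mem_invariantRing (ρ : Representation F G V) {f : CoordRing F V}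
    (hf : f ∈ invariantRing ρ) (i : ℕ) : (scaling F V f).coeff i ∈ invariantRing ρ := by
  intro g
  have := algHom_congr ((Polynomial.mapAlgHom (action ρ g)).comp (scaling F V))
    ((scaling F V).comp (action ρ g)) (fun φ => by
      rw [AlgHom.comp_apply, AlgHom.comp_apply, scaling_coord]
      simp [action, scaling]) f
  rw [AlgHom.comp_apply, AlgHom.comp_apply, hf g] at this
  have h := congrArg (fun q => q.coeff i) this
  simpa using h

/-- The ring of invariants of a finite group is finitely generated. -/
lemma fg_invariantRing [Finite G] [FiniteDimensional F V] (ρ : Representation F G V) :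
    (invariantRing ρ).FG := by
  let inst : MulSemiringAction G (CoordRing F V) :=
    { smul := fun g f => action ρ g f
      one_smul := fun f => by
        change action ρ 1 f = f
        rw [map_one]
        rfl
      mul_smul := fun g h f => by
        change action ρ (g * h) f = action ρ g (action ρ h f)
        rw [map_mul]
        rfl
      smul_zero := fun g => map_zero (action ρ g)
      smul_add := fun g => map_add (action ρ g)
      smul_one := fun g => map_one (action ρ g)
      smul_mul := fun g => map_mul (action ρ g) }
  have : Algebra.IsInvariant (invariantRing ρ) (CoordRing F V) G := ⟨fun b hb => ⟨⟨b, hb⟩, rfl⟩⟩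
  have : Algebra.IsIntegral (invariantRing ρ) (CoordRing F V) :=
    Algebra.IsInvariant.isIntegral (invariantRing ρ) (CoordRing F V) G
  have hft : Algebra.FiniteType F (CoordRing F V) :=
    Algebra.FiniteType.equiv inferInstance
      (SymmetricAlgebra.equivMvPolynomial (Module.finBasis F (Module.Dual F V))).symm
  have : Algebra.FiniteType (invariantRing ρ) (CoordRing F V) :=
    Algebra.FiniteType.of_restrictScalars_finiteType F _ _
  have hfin : Module.Finite (invariantRing ρ) (CoordRing F V) := Algebra.IsIntegral.finite
  exact Subalgebra.fg_top _ |>.1 (fg_of_fg_of_fg F (invariantRing ρ) (CoordRing F V) hft.out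
    hfin.fg_top Subtype.val_injective)

/-- The infimum defining the Noether number is attained. -/
lemma exists_generatedInDegree [Finite G] [FiniteDimensional F V] (ρ : Representation F G V) :
    ∃ d, GeneratedInDegree ρ d := by
  obtain ⟨s, hs⟩ := fg_invariantRing ρ
  refine ⟨s.sup fun f => (scaling F V f).natDegree, le_antisymm
    (Algebra.adjoin_le fun f hf => hf.1) ?_⟩
  conv_lhs => rw [← hs]
  refine Algebra.adjoin_le fun f hf => ?_
  have hinv : f ∈ invariantRing ρ := hs ▸ Algebra.subset_adjoin hf
  rw [← eval_one_scaling f, eval_eq_sum_range]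
  refine sum_mem fun i hi => ?_
  rw [one_pow, mul_one]
  refine Algebra.subset_adjoin ⟨coeff_scaling_mem_invariantRing ρ hinv i, i, ?_,
    coeff_scaling_mem f i⟩
  exact (Nat.lt_succ_iff.1 (Finset.mem_range.1 hi)).trans
    (Finset.le_sup (f := fun f => (scaling F V f).natDegree) hf)

lemma le_beta [Finite G] [FiniteDimensional F V] (ρ : Representation F G V) {d : ℕ}
    (h : ∀ e, GeneratedInDegree ρ e → d ≤ e) : d ≤ beta ρ :=
  h _ (Nat.sInf_mem (exists_generatedInDegree ρ))

end FiniteGeneration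

/-! ### Frames from Jordan bases of the dual module -/

section DualBasis

variable {F V : Type*} [Field F] [AddCommGroup V] [Module F V] {p m n : ℕ}
  {ρ : Representation F (Cyc p) V}

lemma apply_sigma_inv (φ : Module.Dual F V) (v : V) :
    φ (ρ (sigma p)⁻¹ v) = φ v + Delta ρ.dual φ v := by
  simp [Delta, Representation.dual_apply, Module.Dual.transpose_apply]

/-- The vectors dual to a Jordan basis of `V*`. -/
noncomputable def JordanFrame.ofBasis
    (b : Module.Basis ((Fin m × Fin 2) ⊕ Fin (n + 2)) F (Module.Dual F V))
    (hb : IsJordanBasis ρ.dual b) : JordanFrame ρ m n :=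
  have : Module.Finite F V := (Module.finite_dual_iff F).1 (Module.Finite.of_basis b)
  let v : (Fin m × Fin 2) ⊕ Fin (n + 2) → V := fun j => (Module.evalEquiv F V).symm (b.coord j)
  have hv (i j) : b i (v j) = if i = j then 1 else 0 := by
    rw [Module.apply_evalEquiv_symm_apply, Module.Basis.coord_apply, Module.Basis.repr_self,
      Finsupp.single_apply]
  have hext {x y : V} (h : ∀ i, b i x = b i y) : x = y := by
    refine Module.evalEquiv F V |>.injective (b.ext fun i => ?_)
    simpa using h i
  have hΔ (j : Fin (n + 1)) : Delta ρ.dual (b (.inr j.succ)) = b (.inr j.castSucc) :=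
    hb.2.2.1 _ _ (by simp)
  have hΔ0 : Delta ρ.dual (b (.inr 0)) = 0 := hb.2.2.2 0 rfl
  { upper := fun i => v (.inl (i, 0))
    lower := fun i => v (.inl (i, 1))
    chain := fun j => v (.inr j)
    η := fun i => b (.inl (i, 1))
    ζ := b (.inr (Fin.last (n + 1)))
    υ := b (.inr (Fin.last n).castSucc)
    upper_eq := fun i => hext fun k => by
      rw [apply_sigma_inv, map_add]
      congr 1
      rcases k with ⟨k, c⟩ | k
      · fin_cases c
        · simp [hb.2.1, hv]
        · simp [hb.1, hv]
      · refine Fin.cases ?_ (fun k => ?_) k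
        · simp [hΔ0, hv]
        · simp [hΔ, hv]
    lower_eq := fun i => hext fun k => by
      rw [apply_sigma_inv, add_eq_left]
      rcases k with ⟨k, c⟩ | k
      · fin_cases c
        · simp [hb.2.1]
        · simp [hb.1, hv]
      · refine Fin.cases ?_ (fun k => ?_) k
        · simp [hΔ0]
        · simp [hΔ, hv]
    chain_last := hext fun k => by
      rw [apply_sigma_inv, add_eq_left]
      rcases k with ⟨k, c⟩ | k
      · fin_cases c
        · simp [hb.2.1]
        · simp [hb.1, hv]
      · refine Fin.cases ?_ (fun k => ?_) k
        · simp [hΔ0]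
        · simp [hΔ, hv, Fin.castSucc_ne_last]
    chain_castSucc := fun j => hext fun k => by
      rw [apply_sigma_inv, map_add]
      congr 1
      rcases k with ⟨k, c⟩ | k
      · fin_cases c
        · simp [hb.2.1, hv]
        · simp [hb.1, hv]
      · refine Fin.cases ?_ (fun k => ?_) k
        · simp [hΔ0, hv, (Fin.succ_ne_zero j).symm]
        · simp [hΔ, hv]
    η_lower := fun i j => by simp [hv, eq_comm]
    η_chain := fun i => by simp [hv]
    ζ_lower := fun i => by simp [hv]
    ζ_chain := by simp [hv, Fin.ext_iff]
    υ_lower := fun i => by simp [hv]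
    υ_chain := by simp [hv, Fin.ext_iff] }

end DualBasis

/-! ### Frames in reduced modules -/

section Reduced

variable {F V : Type*} [Field F] [AddCommGroup V] [Module F V] {p : ℕ}
  {ρ : Representation F (Cyc p) V}

lemma exists_eq_sigma_inv_pow [NeZero p] (g : Cyc p) : ∃ k : ℕ, g = (sigma p)⁻¹ ^ k := by
  refine ⟨(-g.toAdd).val, ?_⟩
  rw [inv_pow, sigma, ← ofAdd_nsmul, ← ofAdd_neg, nsmul_eq_mul, mul_one, ZMod.natCast_zmod_val,
    neg_neg, ofAdd_toAdd]

lemma sigma_inv_sub_one_pow_apply_eq_zero (k : ℕ) (v : V) :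
    ((ρ (sigma p)⁻¹ - 1) ^ k) v = 0 ↔ (Delta ρ ^ k) v = 0 := by
  have hinv : ρ (sigma p) * ρ (sigma p)⁻¹ = 1 := by rw [← map_mul, mul_inv_cancel, map_one]
  have hinv' : ρ (sigma p)⁻¹ * ρ (sigma p) = 1 := by rw [← map_mul, inv_mul_cancel, map_one]
  have h1 : ρ (sigma p) * (ρ (sigma p)⁻¹ - 1) = -Delta ρ := by
    rw [mul_sub, hinv, mul_one, Delta, neg_sub]
  have hc : Commute (ρ (sigma p)) (ρ (sigma p)⁻¹ - 1) := by
    rw [commute_iff_eq, h1, sub_mul, hinv', one_mul, Delta, neg_sub]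
  have h2 := hc.mul_pow k
  rw [h1, neg_pow, ← map_pow] at h2
  have h3 := LinearMap.congr_fun h2 v
  rw [Module.End.mul_apply, Module.End.mul_apply] at h3
  have hinj : Function.Injective (ρ (sigma p ^ k)) := fun x y h => by
    have := congrArg (ρ (sigma p ^ k)⁻¹) h
    rwa [← Module.End.mul_apply, ← Module.End.mul_apply, ← map_mul, inv_mul_cancel, map_one]
      at this
  rw [← map_eq_zero_iff _ hinj, ← h3]
  rcases neg_one_pow_eq_or (Module.End F V) k with h | h <;> simp [h]

lemma Delta_pow_apply {U : Type*} [AddCommGroup U] [Module F U] {τ : Representation F (Cyc p) U}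
    (f : U →ₗ[F] V) (hf : ∀ g u, f (τ g u) = ρ g (f u)) (k : ℕ) (u : U) :
    (Delta ρ ^ k) (f u) = f ((Delta τ ^ k) u) := by
  induction k with
  | zero => simp
  | succ k ih =>
    rw [pow_succ', pow_succ', Module.End.mul_apply, Module.End.mul_apply, ih]
    simp [Delta, hf]

/-- A fixed vector that is not of the form `σ⁻¹ w - w` would span a trivial summand, with a
complement the kernel of a linear functional that vanishes on all these differences. -/
lemma IsReducedRep.exists_eq_add [NeZero p] (hρ : IsReducedRep ρ) {v : V}
    (hv : v ∈ ρ.invariants) : ∃ w, ρ (sigma p)⁻¹ w = w + v := by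
  by_contra! hne
  have hmem : v ∉ LinearMap.range (ρ (sigma p)⁻¹ - 1) := by
    rintro ⟨w, hw⟩
    refine hne w ?_
    rw [← hw]
    simp
  obtain ⟨f, hfv, hf⟩ := Submodule.exists_le_ker_of_notMem hmem
  have hstab (k : ℕ) (w : V) : f (ρ ((sigma p)⁻¹ ^ k) w) = f w := by
    induction k with
    | zero => simp
    | succ k ih =>
      rw [pow_succ', map_mul, Module.End.mul_apply, ← ih, ← sub_eq_zero, ← map_sub]
      exact hf ⟨ρ ((sigma p)⁻¹ ^ k) w, by simp⟩
  let A : Subrepresentation ρ := ⟨F ∙ v, fun g w hw => by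
    obtain ⟨c, rfl⟩ := Submodule.mem_span_singleton.1 hw
    rw [map_smul, hv g]
    exact hw⟩
  let B : Subrepresentation ρ := ⟨LinearMap.ker f, fun g w hw => by
    obtain ⟨k, rfl⟩ := exists_eq_sigma_inv_pow g
    rw [LinearMap.mem_ker, hstab]
    exact hw⟩
  have hcompl : IsCompl A.toSubmodule B.toSubmodule := by
    constructor
    · rw [Submodule.disjoint_def]
      intro x hx hxB
      obtain ⟨c, rfl⟩ := Submodule.mem_span_singleton.1 hx
      have h : c * f v = 0 := by simpa using LinearMap.mem_ker.1 hxB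
      rw [(mul_eq_zero.1 h).resolve_right hfv, zero_smul]
    · rw [codisjoint_iff, eq_top_iff]
      intro x _
      refine Submodule.mem_sup.2 ⟨(f x / f v) • v, Submodule.mem_span_singleton.2 ⟨_, rfl⟩,
        x - (f x / f v) • v, ?_, by abel⟩
      change f _ = 0
      simp [hfv]
  have hbot := hρ A B hcompl fun g w hw => by
    obtain ⟨c, rfl⟩ := Submodule.mem_span_singleton.1 hw
    rw [map_smul, hv g]
  have : v = 0 := by
    rw [← Submodule.mem_bot F, ← hbot]
    exact Submodule.mem_span_singleton_self v
  exact hfv (by rw [this, map_zero])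

lemma exists_dual_apply_eq {ι : Type*} {u : ι → V} (hu : LinearIndependent F u) (c : ι → F) :
    ∃ f : Module.Dual F V, ∀ i, f (u i) = c i := by
  obtain ⟨f, hf⟩ := LinearMap.exists_extend ((Module.Basis.span hu).constr F c)
  refine ⟨f, fun i => ?_⟩
  have h := LinearMap.congr_fun hf (Module.Basis.span hu i)
  rw [Module.Basis.constr_basis] at h
  rw [← h, LinearMap.comp_apply, Submodule.subtype_apply, Module.Basis.span_apply]

section JordanBlock

variable [Fact p.Prime] [CharP F p] {r : ℕ} (hr : r ≤ p)

lemma Delta_jordanRep : Delta (jordanRep F p r hr) = Matrix.toLin' (shiftMatrix F r) := by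
  rw [Delta, jordanRep_sigma, jordanBlock, map_add, Matrix.toLin'_one]
  exact add_sub_cancel_left _ _

lemma Delta_jordanRep_pow_single (k : ℕ) (j : Fin r) (i : Fin r) :
    (Delta (jordanRep F p r hr) ^ k) (Pi.single j 1) i = if (i : ℕ) + k = j then 1 else 0 := by
  rw [Delta_jordanRep, ← Matrix.toLin'_pow, Matrix.toLin'_apply, Matrix.mulVec_single_one,
    Matrix.col_apply, shiftMatrix_pow]

/-- A vector fixed by a Jordan block is determined by its first coordinate. -/
lemma eq_zero_of_mem_invariants_jordanRep {w : Fin r → F}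
    (hw : w ∈ (jordanRep F p r hr).invariants) (h0 : ∀ h : 0 < r, w ⟨0, h⟩ = 0) : w = 0 := by
  have hΔ : Delta (jordanRep F p r hr) w = 0 := by
    rw [Delta, LinearMap.sub_apply, hw, Module.End.one_apply, sub_self]
  rw [Delta_jordanRep, Matrix.toLin'_apply] at hΔ
  funext i
  rcases i with ⟨i, hi⟩
  rcases i with _ | i
  · exact h0 hi
  · have h := congrFun hΔ ⟨i, by omega⟩
    rw [Matrix.mulVec, dotProduct, Finset.sum_eq_single (⟨i + 1, hi⟩ : Fin r)] at h
    · simpa [shiftMatrix] using h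
    · intro j _ hj
      have : ¬ i + 1 = (j : ℕ) := fun h => hj (Fin.ext h.symm)
      simp [shiftMatrix, this]
    · simp

end JordanBlock

variable [Fact p.Prime] [CharP F p]

/-- A complement of a Jordan block contains all but one dimension of the fixed vectors. -/
lemma finrank_invariants_le [FiniteDimensional F V] {r : ℕ} {hr : r ≤ p}
    {A B : Subrepresentation ρ}
    (hAB : IsCompl A.toSubmodule B.toSubmodule)
    (e : A.toRepresentation.Equiv (jordanRep F p r hr)) :
    Module.finrank F ρ.invariants ≤
      1 + Module.finrank F (ρ.invariants ⊓ B.toSubmodule : Submodule F V) := by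
  have hle : ρ.invariants ≤ (ρ.invariants ⊓ A.toSubmodule) ⊔ (ρ.invariants ⊓ B.toSubmodule) := by
    intro v hv
    obtain ⟨a, ha, b, hb, rfl⟩ :=
      Submodule.mem_sup.1 (hAB.sup_eq_top ▸ Submodule.mem_top : v ∈ A.toSubmodule ⊔ B.toSubmodule)
    have key (g : Cyc p) : ρ g a = a ∧ ρ g b = b := by
      have h := hv g
      rw [map_add] at h
      have h1 : ρ g a - a = b - ρ g b := by
        rw [sub_eq_sub_iff_add_eq_add, h, add_comm]
      have h2 : ρ g a - a = 0 := by
        refine Submodule.disjoint_def.1 hAB.disjoint _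
          (sub_mem (A.apply_mem_toSubmodule g ha) ha) ?_
        rw [h1]
        exact sub_mem hb (B.apply_mem_toSubmodule g hb)
      exact ⟨sub_eq_zero.1 h2, (sub_eq_zero.1 (h1 ▸ h2)).symm⟩
    exact Submodule.mem_sup.2 ⟨a, ⟨fun g => (key g).1, ha⟩, b, ⟨fun g => (key g).2, hb⟩, rfl⟩
  have hA : Module.finrank F (ρ.invariants ⊓ A.toSubmodule : Submodule F V) ≤ 1 := by
    let c : (Fin r → F) →ₗ[F] F := if h : 0 < r then LinearMap.proj ⟨0, h⟩ else 0
    let f : (ρ.invariants ⊓ A.toSubmodule : Submodule F V) →ₗ[F] F :=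
      c ∘ₗ e.toLinearEquiv.toLinearMap ∘ₗ Submodule.inclusion inf_le_right
    have hinj : Function.Injective f := by
      rw [injective_iff_map_eq_zero]
      intro x hx
      have hw : e.toLinearEquiv (Submodule.inclusion inf_le_right x) = 0 := by
        refine eq_zero_of_mem_invariants_jordanRep hr (fun g => ?_) fun h => ?_
        · have := Representation.IntertwiningMap.isIntertwining _ _ e.toIntertwiningMap g
            (Submodule.inclusion inf_le_right x)
          refine this.symm.trans (congrArg e.toIntertwiningMap ?_)
          exact Subtype.ext (x.2.1 g)
        · have hx' : c (e.toLinearEquiv (Submodule.inclusion inf_le_right x)) = 0 := hx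
          simpa [c, h] using hx'
      have hx0 := congrArg Subtype.val ((map_eq_zero_iff _ e.toLinearEquiv.injective).1 hw)
      exact Subtype.ext hx0
    simpa using LinearMap.finrank_le_finrank_of_injective hinj
  calc Module.finrank F ρ.invariants
      ≤ _ := Submodule.finrank_mono hle
    _ ≤ _ := Submodule.finrank_add_le_finrank_add_finrank _ _
    _ ≤ _ := Nat.add_le_add_right hA _

/-- A reduced module with a Jordan block of size at least `n + 2` contains
`(k - 1) V_2 + V_{n + 2}`, where `k` is the dimension of the space of fixed vectors. -/
lemma IsReducedRep.nonempty_jordanFrame [FiniteDimensional F V] (hρ : IsReducedRep ρ) {r n : ℕ}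
    {hr : r ≤ p} (hn : n + 2 ≤ r) (hsum : HasSummand ρ (jordanRep F p r hr)) :
    Nonempty (JordanFrame ρ (Module.finrank F ρ.invariants - 1) n) := by
  obtain ⟨A, B, hAB, ⟨e⟩⟩ := hsum
  obtain ⟨y, hy⟩ := exists_linearIndependent_of_le_finrank (R := F)
    (M := (ρ.invariants ⊓ B.toSubmodule : Submodule F V))
    (n := Module.finrank F ρ.invariants - 1) (by have := finrank_invariants_le hAB e; omega)
  have hyV : LinearIndependent F fun i => (y i : V) :=
    hy.map' _ (Submodule.ker_subtype _)
  choose w hw using fun i => hρ.exists_eq_add (y i).2.1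
  -- the inclusion of the Jordan block
  let f : (Fin r → F) →ₗ[F] V := A.toSubmodule.subtype ∘ₗ e.symm.toLinearEquiv.toLinearMap
  have hfA (u : Fin r → F) : f u ∈ A.toSubmodule := (e.symm.toLinearEquiv u).2
  have hfinj : Function.Injective f :=
    Subtype.val_injective.comp e.symm.toLinearEquiv.injective
  have hf (g : Cyc p) (u : Fin r → F) : f (jordanRep F p r hr g u) = ρ g (f u) :=
    congrArg Subtype.val
      (Representation.IntertwiningMap.isIntertwining _ _ e.symm.toIntertwiningMap g u)
  set δ : Module.End F V := ρ (sigma p)⁻¹ - 1 with hδ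
  let v : V := f (Pi.single ⟨n + 1, by omega⟩ 1)
  have hv0 : (δ ^ (n + 2)) v = 0 := by
    rw [hδ, sigma_inv_sub_one_pow_apply_eq_zero, Delta_pow_apply f hf]
    convert map_zero f
    funext i
    rw [Delta_jordanRep_pow_single, if_neg (by simp; omega), Pi.zero_apply]
  have hv1 : (δ ^ (n + 1)) v ≠ 0 := by
    rw [hδ, Ne, sigma_inv_sub_one_pow_apply_eq_zero, Delta_pow_apply f hf,
      map_eq_zero_iff f hfinj]
    intro h
    have := congrFun h ⟨0, by omega⟩
    rw [Delta_jordanRep_pow_single, if_pos (by simp)] at this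
    exact one_ne_zero this
  have hδA (k : ℕ) : (δ ^ k) v ∈ A.toSubmodule := by
    induction k with
    | zero => exact hfA _
    | succ k ih =>
      rw [pow_succ', Module.End.mul_apply]
      exact sub_mem (A.apply_mem_toSubmodule _ ih) ih
  have hstep (k : ℕ) : ρ (sigma p)⁻¹ ((δ ^ k) v) = (δ ^ k) v + (δ ^ (k + 1)) v := by
    rw [pow_succ', Module.End.mul_apply, hδ]
    simp
  have hpair : LinearIndependent F ![(δ ^ n) v, (δ ^ (n + 1)) v] := by
    rw [LinearIndependent.pair_iff]
    intro s t hst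
    have h1 : s • (δ ^ (n + 1)) v = 0 := by
      have h := congrArg δ hst
      rwa [map_add, map_smul, map_smul, ← Module.End.mul_apply, ← Module.End.mul_apply,
        ← pow_succ', ← pow_succ', hv0, smul_zero, add_zero, map_zero] at h
    have hs := (smul_eq_zero.1 h1).resolve_right hv1
    rw [hs, zero_smul, zero_add] at hst
    exact ⟨hs, (smul_eq_zero.1 hst).resolve_right hv1⟩
  have hind : LinearIndependent F
      (Sum.elim (fun i => (y i : V)) ![(δ ^ n) v, (δ ^ (n + 1)) v]) := by
    refine hyV.sum_type hpair (hAB.disjoint.symm.mono ?_ ?_) <;> rw [Submodule.span_le]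
    · rintro _ ⟨i, rfl⟩
      exact (y i).2.2
    · rintro _ ⟨i, rfl⟩
      fin_cases i
      · exact hδA n
      · exact hδA (n + 1)
  choose d hd using fun j => exists_dual_apply_eq hind fun i => if i = j then 1 else 0
  have hdy (j i) : d j (y i : V) = if Sum.inl i = j then 1 else 0 := hd j (.inl i)
  have hd0 (j) : d j ((δ ^ n) v) = if Sum.inr 0 = j then 1 else 0 := hd j (.inr 0)
  have hd1 (j) : d j ((δ ^ (n + 1)) v) = if Sum.inr 1 = j then 1 else 0 := hd j (.inr 1)
  exact ⟨{
    upper := w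
    lower := fun i => y i
    chain := fun j => (δ ^ (j : ℕ)) v
    η := fun i => d (.inl i)
    ζ := d (.inr 1)
    υ := d (.inr 0)
    upper_eq := hw
    lower_eq := fun i => (y i).2.1 _
    chain_last := by rw [hstep, Fin.val_last, hv0, add_zero]
    chain_castSucc := fun j => hstep j
    η_lower := fun i j => by simp [hdy]
    η_chain := fun i => by simp [hd0, hd1]
    ζ_lower := fun i => by simp [hdy]
    ζ_chain := by simp [hd0, hd1]
    υ_lower := fun i => by simp [hdy]
    υ_chain := by simp [hd0, hd1] }⟩

end Reduced

end NoetherNumber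

theorem theorem2p1 {p : ℕ} [Fact p.Prime] {F : Type*} [Field F] [CharP F p] :
    -- the lower bounds for the Noether number
    (∀ (W : Type*) [AddCommGroup W] [Module F W] [FiniteDimensional F W] [Nontrivial W]
        (ρ : Representation F (Cyc p) W) (k : ℕ),
      IsReducedRep ρ → k = Module.finrank F ρ.invariants →
        ((∃ (n : ℕ) (hn : n ≤ p), 3 < n ∧ HasSummand ρ (jordanRep F p n hn)) →
          k * (p - 1) + (p - 2) ≤ beta ρ) ∧
        ((∃ (n : ℕ) (hn : n ≤ p), 2 < n ∧ HasSummand ρ (jordanRep F p n hn)) →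
          k * (p - 1) + 1 ≤ beta ρ)) ∧
    -- the indecomposable transfer in `F[(k-1)V_2 + V_4]`; here `y_i = b (inl (i, 1))`,
    -- `z = b (inr 3)` and `y = b (inr 2)`
    (∀ (k : ℕ) (_ : 1 ≤ k) (h2 : 2 ≤ p) (h4 : 4 ≤ p)
        (b : Module.Basis ((Fin (k - 1) × Fin 2) ⊕ Fin 4) F
          (Module.Dual F ((DirectSum (Fin (k - 1)) fun _ => Fin 2 → F) × (Fin 4 → F)))),
      IsJordanBasis (twosPlus F p (k - 1) 4 h2 h4).dual b →
        IsIndecomposable (twosPlus F p (k - 1) 4 h2 h4)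
          (transfer (twosPlus F p (k - 1) 4 h2 h4)
            (((∏ i, coord (b (.inl (i, 1)))) * coord (b (.inr 3))) ^ (p - 1) *
              coord (b (.inr 2)) ^ (p - 2)))) ∧
    -- the indecomposable transfer in `F[(k-1)V_2 + V_3]`; here `y_i = b (inl (i, 1))`,
    -- `z = b (inr 2)` and `y = b (inr 1)`
    (∀ (k : ℕ) (_ : 1 ≤ k) (h2 : 2 ≤ p) (h3 : 3 ≤ p)
        (b : Module.Basis ((Fin (k - 1) × Fin 2) ⊕ Fin 3) F
          (Module.Dual F ((DirectSum (Fin (k - 1)) fun _ => Fin 2 → F) × (Fin 3 → F)))),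
      IsJordanBasis (twosPlus F p (k - 1) 3 h2 h3).dual b →
        IsIndecomposable (twosPlus F p (k - 1) 3 h2 h3)
          (transfer (twosPlus F p (k - 1) 3 h2 h3)
            (((∏ i, coord (b (.inl (i, 1)))) * coord (b (.inr 2))) ^ (p - 1) *
              coord (b (.inr 1))))) := by
  refine ⟨fun W _ _ _ _ ρ k hρ hk => ⟨?_, ?_⟩, ?_, ?_⟩
  · rintro ⟨r, hr, h3, hsum⟩
    obtain ⟨D⟩ := hρ.nonempty_jordanFrame (n := 2) (by omega) hsum
    refine le_beta ρ fun d hd => le_trans ?_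
      (D.le_of_generatedInDegree (e := p - 2) (by omega) (D.topCoeff_sq_of_four (by omega)) hd)
    rw [← hk]
    rcases k with _ | k
    · omega
    · rw [Nat.add_sub_cancel, add_mul]
      omega
  · rintro ⟨r, hr, h2, hsum⟩
    obtain ⟨D⟩ := hρ.nonempty_jordanFrame (n := 1) (by omega) hsum
    refine le_beta ρ fun d hd => le_trans ?_
      (D.le_of_generatedInDegree (e := 1) one_pos (D.topCoeff_sq_of_three (by omega)) hd)
    rw [← hk]
    rcases k with _ | k
    · omega
    · rw [Nat.add_sub_cancel, add_mul]
      omega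
  · intro k _ h2 h4 b hb
    let D := JordanFrame.ofBasis (n := 2) b hb
    exact D.isIndecomposable_transfer (e := p - 2) (by omega) (D.topCoeff_sq_of_four h4)
  · intro k _ h2 h3 b hb
    let D := JordanFrame.ofBasis (n := 1) b hb
    have h := D.isIndecomposable_transfer (e := 1) one_pos (D.topCoeff_sq_of_three h3)
    rw [JordanFrame.monomial, pow_one] at h
    exact h
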